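/- Let $n>1$. A convex polytope means the boundary $P=\partial K$ of a bounded set $K=\{y\in\mathbb{R}^n:\langle u_i,y\rangle\le d_i,\ 1\le i\le s\}$ with non-empty interior, where the $u_i$ are unit vectors, the $d_i$ are real, and each bounding hyperplane $H_i=\{\langle u_i,y\rangle=d_i\}$ meets $K$ in an $(n-1)$-dimensional face. A homothet of $P$ centred at $x$ is a set $x+rP$ with $r\ne 0$. Let $\dim_M$ denote the upper Minkowski (box) dimension ($+\infty$ on unbounded sets) and $\dim_P$ the packing dimension. For $m\in\mathbb{N}$ let $f^M(m)$ and $f^P(m)$ be the infimum of $\dim_M A$, respectively $\dim_P A$, over the sets $A\subset\mathbb{R}$ that contain an $m$-term arithmetic progression with every common difference in $[0,1]$. Let $h_n^M(P)$ and $h_n^P(P)$ be the infimum of $\dim_M B$, respectively $\dim_P B$, over the sets $B\subset\mathbb{R}^n$ that contain a homothet of $P$ centred at each point of the segment $[0,1]\times\{0\}^{n-1}$, and let $g_n^M(P)$, $g_n^P(P)$ be the analogous infima for homothets centred at each point of the cube $[0,1]^n$. Let $F_k(N)$ be the size of the smallest set of integers that contains a $k$-term arithmetic progression with common difference $d$ for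 each $d\in\{1,\dots,N\}$; the arithmetic Kakeya conjecture (AKC) states that \[\lim_{k\to\infty}\lim_{N\to\infty}\frac{\log F_k(N)}{\log N}=1 .\] (1) Let $P$ be a convex polytope as above, none of whose bounding hyperplanes passes through the origin, and suppose that its faces carry real labels $j_i$ with $j_i d_i=(u_i)_1$ for all $i$ (that is, $d_i=(u_i)_1/j_i$ when $j_i\neq0$), such that the set of labels is an arithmetic progression of length $m$ (with non-zero common difference; several faces may share a label). Then $f^M(m)=f^P(m)=:f(m)$ and \[h_n^M(P)=h_n^P(P)=n-1+f(m).\] (2) There is a sequence of convex polytopes $(P_k)_{k\in\mathbb{N}}$ in $\mathbb{R}^n$ converging in the Hausdorff metric to the sphere $S^{n-1}$ such that AKC is equivalent to $h_n^M(P_k)\to n$ and also to $h_n^P(P_k)\to n$ as $k\to\infty$; moreover AKC implies $g_n^M(P_k)\to n$ and $g_n^P(P_k)\to n$. -/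

import Mathlib

open Filter Topology
open scoped NNReal ENNReal

noncomputable section

namespace HarmonicPolytope

/-! ### Minkowski and packing dimension -/

/-- Minkowski (upper box) dimension: `limsup_{ε → 0+} log N_E(ε) / log (1/ε)`, where `N_E(ε)` is
the least positive number of closed `ε`-balls covering `E`; it is `⊤` when `E` is not totally
bounded. -/
def dimM {X : Type*} [PseudoEMetricSpace X] (E : Set X) : EReal :=
  limsup (fun ε : ℝ≥0 =>
    ENNReal.log (max 1 (Metric.externalCoveringNumber ε E : ℝ≥0∞)) /
      ((Real.log (1 / (ε : ℝ)) : ℝ) : EReal)) (𝓝[>] 0)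

/-- Packing dimension, as modified upper box dimension. -/
def dimP {X : Type*} [PseudoEMetricSpace X] (E : Set X) : EReal :=
  ⨅ (s : ℕ → Set X) (_ : E ⊆ ⋃ j, s j), ⨆ j, dimM (s j)

/-! ### Arithmetic progressions -/

/-- `A` contains a `k`-term arithmetic progression with common difference `d`. -/
def ContainsAP {R : Type*} [Semiring R] (k : ℕ) (d : R) (A : Set R) : Prop :=
  ∃ a : R, ∀ i : ℕ, i < k → a + (i : R) * d ∈ A

/-- `F_k(N)`: the least size of a set of integers containing a `k`-term arithmetic progression
with common difference `d` for each `d ∈ {1, …, N}`. -/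
def apNumber (k N : ℕ) : ℕ :=
  sInf {c : ℕ | ∃ A : Finset ℤ, A.card = c ∧
    ∀ d : ℕ, 1 ≤ d → d ≤ N → ContainsAP k (d : ℤ) (A : Set ℤ)}

/-- The arithmetic Kakeya conjecture: `lim_{k → ∞} lim_{N → ∞} log F_k(N) / log N = 1`. -/
def ArithmeticKakeya : Prop :=
  ∃ L : ℕ → ℝ,
    (∀ k : ℕ, 1 ≤ k →
      Tendsto (fun N : ℕ => Real.log (apNumber k N) / Real.log N) atTop (𝓝 (L k))) ∧
    Tendsto L atTop (𝓝 1)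

/-- `A ⊆ ℝ` contains a `k`-term arithmetic progression with every common difference in `[0,1]`. -/
def IsAPSet (k : ℕ) (A : Set ℝ) : Prop :=
  ∀ t ∈ Set.Icc (0 : ℝ) 1, ContainsAP k t A

/-- `f^M(k)`. -/
def fM (k : ℕ) : EReal := ⨅ (A : Set ℝ) (_ : IsAPSet k A), dimM A

/-- `f^P(k)`. -/
def fP (k : ℕ) : EReal := ⨅ (A : Set ℝ) (_ : IsAPSet k A), dimP A

/-! ### Polytopes -/

/-- The intersection of the half-spaces `⟨u i, y⟩ ≤ d i`. -/
def body {n s : ℕ} (u : Fin s → EuclideanSpace ℝ (Fin n)) (d : Fin s → ℝ) :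
    Set (EuclideanSpace ℝ (Fin n)) :=
  {y | ∀ i, inner ℝ (u i) y ≤ d i}

/-- The hyperplane with normal `u` and signed distance `d` from the origin. -/
def hyperplane {n : ℕ} (u : EuclideanSpace ℝ (Fin n)) (d : ℝ) :
    Set (EuclideanSpace ℝ (Fin n)) :=
  {y | inner ℝ u y = d}

/-- `P` is the boundary of a convex polytope (a bounded intersection of finitely many half-spaces
with non-empty interior), whose bounding hyperplanes are the hyperplanes with outward unit normals
`u i` and signed distances `d i` from the origin; each of them carries an `(n-1)`-dimensional
face. -/
structure IsPolytopeWith {n s : ℕ} (u : Fin s → EuclideanSpace ℝ (Fin n)) (d : Fin s → ℝ)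
    (P : Set (EuclideanSpace ℝ (Fin n))) : Prop where
  norm_normal : ∀ i, ‖u i‖ = 1
  bounded : Bornology.IsBounded (body u d)
  interior_nonempty : (interior (body u d)).Nonempty
  facet : ∀ i, Module.finrank ℝ (vectorSpan ℝ (body u d ∩ hyperplane (u i) (d i))) + 1 = n
  eq_frontier : P = frontier (body u d)

/-- `P` is (the boundary of) a convex polytope. -/
def IsConvexPolytope {n : ℕ} (P : Set (EuclideanSpace ℝ (Fin n))) : Prop :=
  ∃ (s : ℕ) (u : Fin s → EuclideanSpace ℝ (Fin n)) (d : Fin s → ℝ), IsPolytopeWith u d P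

/-- The faces of the polytope carry labels `j i`, whose values form an arithmetic progression of
length `m` of real numbers, such that `j i * d i` is the first coordinate of `u i`. No bounding
hyperplane passes through the origin. Distinct faces may share a label. -/
structure IsHarmonic {n s : ℕ} [NeZero n] (u : Fin s → EuclideanSpace ℝ (Fin n)) (d : Fin s → ℝ)
    (j : Fin s → ℝ) (m : ℕ) : Prop where
  dist_ne_zero : ∀ i, d i ≠ 0
  progression : ∃ a q : ℝ, q ≠ 0 ∧ Set.range j = {t | ∃ l : ℕ, l < m ∧ t = a + l * q}
  first_coord : ∀ i, j i * d i = u i 0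

/-! ### Sets containing homothets -/

/-- For each `x ∈ S`, the set `B` contains a homothet `x + r • P`, `r ≠ 0`, centred at `x`. -/
def ContainsHomothets {n : ℕ} (P S B : Set (EuclideanSpace ℝ (Fin n))) : Prop :=
  ∀ x ∈ S, ∃ r : ℝ, r ≠ 0 ∧ ∀ y ∈ P, x + r • y ∈ B

/-- The segment `[0,1] × {0}^{n-1}`. -/
def unitSegment (n : ℕ) [NeZero n] : Set (EuclideanSpace ℝ (Fin n)) :=
  {x | x 0 ∈ Set.Icc (0 : ℝ) 1 ∧ ∀ i, i ≠ 0 → x i = 0}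

/-- The cube `[0,1]^n`. -/
def unitCube (n : ℕ) : Set (EuclideanSpace ℝ (Fin n)) :=
  {x | ∀ i, x i ∈ Set.Icc (0 : ℝ) 1}

/-- The infimum of `dimM B` over sets `B` containing a homothet of `P` centred at each point
of `S`. -/
def leastDimM {n : ℕ} (P S : Set (EuclideanSpace ℝ (Fin n))) : EReal :=
  ⨅ (B : Set (EuclideanSpace ℝ (Fin n))) (_ : ContainsHomothets P S B), dimM B

/-- The infimum of `dimP B` over sets `B` containing a homothet of `P` centred at each point
of `S`. -/
def leastDimP {n : ℕ} (P S : Set (EuclideanSpace ℝ (Fin n))) : EReal :=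
  ⨅ (B : Set (EuclideanSpace ℝ (Fin n))) (_ : ContainsHomothets P S B), dimP B

/-- `h_n^M(P)`. -/
def hM {n : ℕ} [NeZero n] (P : Set (EuclideanSpace ℝ (Fin n))) : EReal :=
  leastDimM P (unitSegment n)

/-- `h_n^P(P)`. -/
def hP {n : ℕ} [NeZero n] (P : Set (EuclideanSpace ℝ (Fin n))) : EReal :=
  leastDimP P (unitSegment n)

/-- `g_n^M(P)`. -/
def gM {n : ℕ} (P : Set (EuclideanSpace ℝ (Fin n))) : EReal := leastDimM P (unitCube n)

/-- `g_n^P(P)`. -/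
def gP {n : ℕ} (P : Set (EuclideanSpace ℝ (Fin n))) : EReal := leastDimP P (unitCube n)

end HarmonicPolytope

end

/-!
If a homothet of `P` has centre `(t, 0, …, 0)` and ratio `r`, its face with normal `uᵢ` lies in the
hyperplane `⟪uᵢ, y⟫ = dᵢ (t jᵢ + r)`. As the labels `jᵢ` form an arithmetic progression, the numbers
`t jᵢ + r` form an `m`-term one whose difference is proportional to `t`. Conversely, the slabs over
the dilates `dᵢ A` of a set `A` with progressions of all differences contain homothets centred at
every point of the segment, and a slab over a set of dimension `z` has dimension `n - 1 + z`.

For the lower bound, let `B` contain all the homothets. When `dim_P B < z`, it is covered by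
countably many closed sets `C k`, increasing in `k`, of box dimension at most `z`. By Baire's
theorem each face of a homothet meets some `C k` in a disc of dimension `n - 1`, and there are an
index and a radius that serve all faces of the homothets with a somewhere dense set of centres.
Counting net points near discs, the heights of the discs form a set of box dimension at most
`z - (n - 1)`, which yields progressions with a somewhere dense set of differences; taking the
closure and countably many dilates yields all of them. The same use of Baire's theorem in dimension
one gives `fM m = fP m`.

A finite set of integers with progressions of the differences `1, …, N` gives, through expansions
in base `N`, a self-similar set of reals, and rounding a set of reals gives a finite set of
integers; so the inner limit in AKC is `fM k`, and AKC says that `fM k → 1`. The polytopes are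
circumscribed about the unit sphere, with contact points in a fine net whose first coordinates are
equally spaced; these coordinates are the labels, since `dᵢ = 1`.
-/

namespace HarmonicPolytope

/-! ### Covering exponents -/

section BoxBound

variable {X Y : Type*} [PseudoMetricSpace X] [PseudoMetricSpace Y]

/-- The exponent `s` bounds the growth of the covering numbers of `E`: for every `ε < 1` the set
`E` is covered by at most `C * ε ^ (-s)` closed `ε`-balls. The upper box dimension of `E` is the
infimum of such `s ≥ 0`; unlike that infimum, the bound at a given exponent is stable under finite
unions, closures, Lipschitz images and products without any limiting argument. -/
def BoxBound (E : Set X) (s : ℝ) : Prop :=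
  ∃ C : ℝ, 0 < C ∧ ∀ ε : ℝ, 0 < ε → ε < 1 →
    ∃ F : Finset X, (F.card : ℝ) ≤ C * ε ^ (-s) ∧ ∀ x ∈ E, ∃ y ∈ F, dist x y ≤ ε

lemma externalCoveringNumber_le_ofReal_iff {E : Set X} {ε : ℝ≥0} {c : ℝ} (hc : 0 ≤ c) :
    (Metric.externalCoveringNumber ε E : ℝ≥0∞) ≤ ENNReal.ofReal c ↔
      ∃ F : Finset X, (F.card : ℝ) ≤ c ∧ ∀ x ∈ E, ∃ y ∈ F, dist x y ≤ ε := by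
  have isCover_iff (D : Set X) :
      Metric.IsCover ε E D ↔ ∀ x ∈ E, ∃ y ∈ D, dist x y ≤ ε := by
    simp only [Metric.IsCover, SetRel.IsCover, Set.mem_ofPred_eq, edist_nndist,
      ENNReal.coe_le_coe, ← NNReal.coe_le_coe, coe_nndist]
  constructor
  · intro h
    have hfin : Metric.externalCoveringNumber ε E < ⊤ := by
      exact_mod_cast h.trans_lt ENNReal.ofReal_lt_top
    obtain ⟨D, hD, hcov⟩ : ∃ D : Set X,
        D.encard = Metric.externalCoveringNumber ε E ∧ Metric.IsCover ε E D := by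
      have : Nonempty {D : Set X // Metric.IsCover ε E D} := ⟨⟨E, by simp⟩⟩
      obtain ⟨⟨D, hD⟩, h⟩ := ENat.exists_eq_iInf
        (fun D : {D : Set X // Metric.IsCover ε E D} => D.1.encard)
      exact ⟨D, by rw [Metric.externalCoveringNumber, h, iInf_subtype], hD⟩
    rw [← hD] at h hfin
    obtain ⟨F, rfl⟩ := (Set.encard_lt_top_iff.1 hfin).exists_finset_coe
    refine ⟨F, ?_, (isCover_iff F).1 hcov⟩
    simpa [ENNReal.natCast_le_ofReal, ENNReal.le_ofReal_iff_toReal_le, hc] using h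
  · rintro ⟨F, hF, hcov⟩
    have hle := ((isCover_iff F).2 hcov).externalCoveringNumber_le_encard
    rw [Set.encard_coe_eq_coe_finsetCard] at hle
    calc (Metric.externalCoveringNumber ε E : ℝ≥0∞) ≤ (F.card : ℝ≥0∞) := by exact_mod_cast hle
      _ = ENNReal.ofReal F.card := by simp
      _ ≤ ENNReal.ofReal c := ENNReal.ofReal_le_ofReal hF

lemma log_externalCoveringNumber_div_le_iff {E : Set X} {ε : ℝ≥0} (h0 : 0 < ε) (h1 : ε < 1)
    {z : ℝ} (hz : 0 ≤ z) :
    ENNReal.log (max 1 (Metric.externalCoveringNumber ε E : ℝ≥0∞)) /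
        ((Real.log (1 / (ε : ℝ)) : ℝ) : EReal) ≤ z ↔
      ∃ F : Finset X, (F.card : ℝ) ≤ (ε : ℝ) ^ (-z) ∧ ∀ x ∈ E, ∃ y ∈ F, dist x y ≤ ε := by
  have hε : (0 : ℝ) < ε := by exact_mod_cast h0
  have hε1 : (ε : ℝ) < 1 := by exact_mod_cast h1
  have hlog : 0 < Real.log (1 / (ε : ℝ)) := Real.log_pos (by rw [lt_div_iff₀ hε]; linarith)
  have hpow : 0 < (ε : ℝ) ^ (-z) := Real.rpow_pos_of_pos hε _
  have hone : 1 ≤ (ε : ℝ) ^ (-z) :=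
    Real.one_le_rpow_of_pos_of_le_one_of_nonpos hε hε1.le (by linarith)
  have hlogpow : ((Real.log (1 / (ε : ℝ)) : ℝ) : EReal) * z =
      ENNReal.log (ENNReal.ofReal ((ε : ℝ) ^ (-z))) := by
    rw [ENNReal.log_ofReal_of_pos hpow, Real.log_rpow hε, ← EReal.coe_mul, one_div, Real.log_inv]
    congr 1
    ring
  rw [EReal.div_le_iff_le_mul (by exact_mod_cast hlog) (EReal.coe_ne_top _), hlogpow,
    ENNReal.log_le_log_iff, max_le_iff, externalCoveringNumber_le_ofReal_iff hpow.le,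
    and_iff_right (by simpa using ENNReal.ofReal_le_ofReal hone)]

lemma eventually_pos_lt_one : ∀ᶠ ε : ℝ≥0 in 𝓝[>] 0, 0 < ε ∧ ε < 1 :=
  Ioo_mem_nhdsGT one_pos

lemma dimM_nonneg (E : Set X) : 0 ≤ dimM E := by
  refine le_limsup_of_frequently_le (Eventually.frequently ?_) (by isBoundedDefault)
  filter_upwards [eventually_pos_lt_one] with ε ⟨h0, h1⟩
  have hε : (0 : ℝ) < ε := by exact_mod_cast h0
  have hε1 : (ε : ℝ) < 1 := by exact_mod_cast h1
  refine EReal.div_nonneg (by simp) (EReal.coe_nonneg.2 (Real.log_nonneg ?_))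
  rw [le_div_iff₀ hε, one_mul]
  exact hε1.le

lemma dimM_empty : dimM (∅ : Set X) = 0 := by
  simp [dimM]

lemma dimP_le_dimM (E : Set X) : dimP E ≤ dimM E :=
  (iInf₂_le (fun _ => E) (Set.subset_iUnion (fun _ : ℕ => E) 0)).trans (by simp)

lemma dimP_nonneg (E : Set X) : 0 ≤ dimP E :=
  le_iInf₂ fun S _ => (dimM_nonneg (S 0)).trans (le_iSup (fun j => dimM (S j)) 0)

lemma BoxBound.dimM_le {E : Set X} {s : ℝ} (hs : 0 ≤ s) (h : BoxBound E s) : dimM E ≤ s := by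
  obtain ⟨C, -, hcover⟩ := h
  refine EReal.le_of_forall_lt_iff_le.1 fun z hz => limsup_le_of_le (by isBoundedDefault) ?_
  have hsz : 0 < z - s := sub_pos.2 (by exact_mod_cast hz)
  have hsmall : ∀ᶠ ε : ℝ≥0 in 𝓝[>] 0, C * (ε : ℝ) ^ (z - s) < 1 := by
    have hcont : ContinuousAt (fun ε : ℝ≥0 => C * (ε : ℝ) ^ (z - s)) 0 :=
      continuousAt_const.mul
        ((NNReal.continuous_coe.continuousAt).rpow_const (Or.inr hsz.le))
    refine nhdsWithin_le_nhds (hcont.eventually (gt_mem_nhds ?_))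
    simp [Real.zero_rpow hsz.ne']
  filter_upwards [eventually_pos_lt_one, hsmall] with ε ⟨h0, h1⟩ hε
  have hpos : (0 : ℝ) < ε := by exact_mod_cast h0
  obtain ⟨F, hF, hcov⟩ := hcover ε hpos (by exact_mod_cast h1)
  refine (log_externalCoveringNumber_div_le_iff h0 h1 (by linarith)).2 ⟨F, ?_, hcov⟩
  calc (F.card : ℝ) ≤ C * (ε : ℝ) ^ (-s) := hF
    _ = C * (ε : ℝ) ^ (z - s) * (ε : ℝ) ^ (-z) := by
        rw [mul_assoc, ← Real.rpow_add hpos]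
        congr 2
        ring
    _ ≤ (ε : ℝ) ^ (-z) := mul_le_of_le_one_left (Real.rpow_nonneg hpos.le _) hε.le

lemma boxBound_of_eventually {E : Set X} {s : ℝ} (hs : 0 ≤ s)
    (h : ∀ᶠ ε : ℝ≥0 in 𝓝[>] 0, ∃ F : Finset X, (F.card : ℝ) ≤ (ε : ℝ) ^ (-s) ∧
      ∀ x ∈ E, ∃ y ∈ F, dist x y ≤ ε) : BoxBound E s := by
  obtain ⟨δ, hδ, hsub⟩ := (mem_nhdsGT_iff_exists_Ioc_subset).1 h
  obtain ⟨F₀, hF₀, hcov₀⟩ := hsub ⟨hδ, le_rfl⟩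
  have hδpow : (0 : ℝ) < (δ : ℝ) ^ (-s) := Real.rpow_pos_of_pos (by exact_mod_cast hδ) _
  refine ⟨(δ : ℝ) ^ (-s) + 1, by positivity, fun ε h0 h1 => ?_⟩
  have hone : 1 ≤ ε ^ (-s) := Real.one_le_rpow_of_pos_of_le_one_of_nonpos h0 h1.le (by linarith)
  rcases le_total ε δ with hle | hge
  · lift ε to ℝ≥0 using h0.le
    obtain ⟨F, hF, hcov⟩ := hsub ⟨by exact_mod_cast h0, by exact_mod_cast hle⟩
    exact ⟨F, by nlinarith, hcov⟩
  · refine ⟨F₀, by nlinarith, fun x hx => ?_⟩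
    obtain ⟨y, hy, hxy⟩ := hcov₀ x hx
    exact ⟨y, hy, hxy.trans hge⟩

lemma boxBound_of_dimM_lt {E : Set X} {s : ℝ} (h : dimM E < s) : BoxBound E s := by
  have hs : 0 ≤ s := by exact_mod_cast ((dimM_nonneg E).trans_lt h).le
  refine boxBound_of_eventually hs ?_
  filter_upwards [eventually_lt_of_limsup_lt h, eventually_pos_lt_one] with ε hε ⟨h0, h1⟩
  exact (log_externalCoveringNumber_div_le_iff h0 h1 hs).1 hε.le

lemma BoxBound.mono {E E' : Set X} {s s' : ℝ} (h : BoxBound E s) (hE : E' ⊆ E) (hs : s ≤ s') :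
    BoxBound E' s' := by
  obtain ⟨C, hC, hcover⟩ := h
  refine ⟨C, hC, fun ε h0 h1 => ?_⟩
  obtain ⟨F, hF, hcov⟩ := hcover ε h0 h1
  refine ⟨F, hF.trans ?_, fun x hx => hcov x (hE hx)⟩
  exact mul_le_mul_of_nonneg_left
    (Real.rpow_le_rpow_of_exponent_ge h0 h1.le (by linarith)) hC.le

lemma BoxBound.nonneg {E : Set X} {s : ℝ} (h : BoxBound E s) (hE : E.Nonempty) : 0 ≤ s := by
  by_contra! hs
  obtain ⟨C, -, hcover⟩ := h
  obtain ⟨x, hx⟩ := hE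
  have hcont : ContinuousAt (fun ε : ℝ => C * ε ^ (-s)) 0 :=
    continuousAt_const.mul (continuousAt_id.rpow_const (Or.inr (by linarith)))
  have hsmall : ∀ᶠ ε : ℝ in 𝓝[>] 0, C * ε ^ (-s) < 1 := by
    refine nhdsWithin_le_nhds (hcont.eventually (gt_mem_nhds ?_))
    simp [Real.zero_rpow (neg_pos.2 hs).ne']
  obtain ⟨ε, hε, h0, h1⟩ := (hsmall.and (Ioo_mem_nhdsGT one_pos)).exists
  obtain ⟨F, hF, hcov⟩ := hcover ε h0 h1
  obtain ⟨y, hy, -⟩ := hcov x hx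
  have hcard : (1 : ℝ) ≤ F.card := by exact_mod_cast Finset.card_pos.2 ⟨y, hy⟩
  linarith

lemma boxBound_empty (s : ℝ) : BoxBound (∅ : Set X) s :=
  ⟨1, one_pos, fun ε h0 _ => ⟨∅, by simpa using Real.rpow_nonneg h0.le _, by simp⟩⟩

lemma BoxBound.union {E E' : Set X} {s : ℝ} (h : BoxBound E s) (h' : BoxBound E' s) :
    BoxBound (E ∪ E') s := by
  classical
  obtain ⟨C, hC, hcover⟩ := h
  obtain ⟨C', hC', hcover'⟩ := h'
  refine ⟨C + C', by positivity, fun ε h0 h1 => ?_⟩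
  obtain ⟨F, hF, hcov⟩ := hcover ε h0 h1
  obtain ⟨F', hF', hcov'⟩ := hcover' ε h0 h1
  refine ⟨F ∪ F', ?_, ?_⟩
  · have : ((F ∪ F').card : ℝ) ≤ F.card + F'.card := by exact_mod_cast Finset.card_union_le F F'
    linarith
  · rintro x (hx | hx)
    · obtain ⟨y, hy, hxy⟩ := hcov x hx
      exact ⟨y, Finset.mem_union_left _ hy, hxy⟩
    · obtain ⟨y, hy, hxy⟩ := hcov' x hx
      exact ⟨y, Finset.mem_union_right _ hy, hxy⟩

lemma BoxBound.biUnion {ι : Type*} {E : ι → Set X} {s : ℝ} (I : Finset ι)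
    (h : ∀ i ∈ I, BoxBound (E i) s) : BoxBound (⋃ i ∈ I, E i) s := by
  classical
  induction I using Finset.induction_on with
  | empty => simpa using boxBound_empty s
  | insert a I _ ih =>
    rw [Finset.set_biUnion_insert]
    exact (h a (Finset.mem_insert_self a I)).union
      (ih fun i hi => h i (Finset.mem_insert_of_mem hi))

lemma BoxBound.iUnion {ι : Type*} [Finite ι] {E : ι → Set X} {s : ℝ}
    (h : ∀ i, BoxBound (E i) s) : BoxBound (⋃ i, E i) s := by
  have := Fintype.ofFinite ι
  simpa using BoxBound.biUnion Finset.univ fun i _ => h i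

lemma BoxBound.closure {E : Set X} {s : ℝ} (h : BoxBound E s) : BoxBound (closure E) s := by
  obtain ⟨C, hC, hcover⟩ := h
  refine ⟨C, hC, fun ε h0 h1 => ?_⟩
  obtain ⟨F, hF, hcov⟩ := hcover ε h0 h1
  have hclosed : IsClosed (⋃ y ∈ F, Metric.closedBall y ε) :=
    F.finite_toSet.isClosed_biUnion fun y _ => Metric.isClosed_closedBall
  refine ⟨F, hF, fun x hx => ?_⟩
  simpa using closure_minimal (fun z hz => by simpa using hcov z hz) hclosed hx

lemma BoxBound.isBounded {E : Set X} {s : ℝ} (h : BoxBound E s) : Bornology.IsBounded E := by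
  obtain ⟨C, -, hcover⟩ := h
  obtain ⟨F, -, hcov⟩ := hcover (1 / 2) (by norm_num) (by norm_num)
  have : Bornology.IsBounded (⋃ y ∈ F, Metric.closedBall y (1 / 2)) := by
    rw [Bornology.isBounded_biUnion_finset]
    exact fun y _ => Metric.isBounded_closedBall
  exact this.subset fun z hz => by simpa using hcov z hz

lemma BoxBound.exists_cover_div {E : Set X} {s : ℝ} (h : BoxBound E s) {K : ℝ} (hK : 1 ≤ K) :
    ∃ C : ℝ, 0 < C ∧ ∀ ε : ℝ, 0 < ε → ε < 1 →
      ∃ F : Finset X, (F.card : ℝ) ≤ C * ε ^ (-s) ∧ ∀ x ∈ E, ∃ y ∈ F, dist x y ≤ ε / K := by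
  obtain ⟨C, hC, hcover⟩ := h
  have hK0 : 0 < K := by linarith
  refine ⟨C * K ^ s, by positivity, fun ε h0 h1 => ?_⟩
  obtain ⟨F, hF, hcov⟩ := hcover (ε / K) (by positivity) (by rw [div_lt_one hK0]; linarith)
  refine ⟨F, ?_, hcov⟩
  rw [Real.div_rpow h0.le hK0.le, Real.rpow_neg hK0.le, div_inv_eq_mul] at hF
  linarith

lemma BoxBound.image {E : Set X} {s : ℝ} (h : BoxBound E s) {f : X → Y} {K : ℝ≥0}
    (hf : LipschitzWith K f) : BoxBound (f '' E) s := by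
  classical
  obtain ⟨C, hC, hcover⟩ := h.exists_cover_div (K := K + 1) (by simp)
  refine ⟨C, hC, fun ε h0 h1 => ?_⟩
  obtain ⟨F, hF, hcov⟩ := hcover ε h0 h1
  refine ⟨F.image f, le_trans (by exact_mod_cast Finset.card_image_le) hF, ?_⟩
  rintro _ ⟨x, hx, rfl⟩
  obtain ⟨y, hy, hxy⟩ := hcov x hx
  refine ⟨f y, Finset.mem_image_of_mem f hy, ?_⟩
  rw [le_div_iff₀ (by positivity)] at hxy
  have := hf.dist_le_mul x y
  nlinarith [dist_nonneg (x := x) (y := y)]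

lemma BoxBound.prod {S : Set X} {T : Set Y} {s t : ℝ} (hS : BoxBound S s) (hT : BoxBound T t) :
    BoxBound (S ×ˢ T) (s + t) := by
  obtain ⟨C, hC, hcover⟩ := hS
  obtain ⟨C', hC', hcover'⟩ := hT
  refine ⟨C * C', by positivity, fun ε h0 h1 => ?_⟩
  obtain ⟨F, hF, hcov⟩ := hcover ε h0 h1
  obtain ⟨F', hF', hcov'⟩ := hcover' ε h0 h1
  refine ⟨F ×ˢ F', ?_, ?_⟩
  · calc ((F ×ˢ F').card : ℝ) = F.card * F'.card := by simp
      _ ≤ (C * ε ^ (-s)) * (C' * ε ^ (-t)) := by gcongr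
      _ = C * C' * ε ^ (-(s + t)) := by rw [neg_add, Real.rpow_add h0]; ring
  · rintro ⟨x, y⟩ ⟨hx, hy⟩
    obtain ⟨x', hx', hxx'⟩ := hcov x hx
    obtain ⟨y', hy', hyy'⟩ := hcov' y hy
    exact ⟨(x', y'), by simp [hx', hy'], max_le hxx' hyy'⟩

lemma exists_finset_cover_of_card_separated_le {E : Set X} {r N : ℝ} (hr : 0 ≤ r)
    (h : ∀ F : Finset X, (F : Set X) ⊆ E → (F : Set X).Pairwise (fun x y => r < dist x y) →
      (F.card : ℝ) ≤ N) :
    ∃ F : Finset X, (F.card : ℝ) ≤ N ∧ ∀ x ∈ E, ∃ y ∈ F, dist x y ≤ r := by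
  classical
  let cards : Set ℕ := {c | ∃ F : Finset X, (F : Set X) ⊆ E ∧
    (F : Set X).Pairwise (fun x y => r < dist x y) ∧ F.card = c}
  have hbdd : BddAbove cards := by
    refine ⟨⌊N⌋₊, ?_⟩
    rintro _ ⟨F, hFE, hsep, rfl⟩
    exact Nat.le_floor (h F hFE hsep)
  have hne : cards.Nonempty := ⟨0, ∅, by simp, by simp, rfl⟩
  obtain ⟨F, hFE, hsep, hmax⟩ := Nat.sSup_mem hne hbdd
  refine ⟨F, h F hFE hsep, fun x hx => ?_⟩
  by_contra! hfar
  have hxF : x ∉ F := fun hxF => absurd (hfar x hxF) (by simpa using hr)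
  have hmem : F.card + 1 ∈ cards := by
    refine ⟨insert x F, ?_, ?_, Finset.card_insert_of_notMem hxF⟩ <;> rw [Finset.coe_insert]
    · exact Set.insert_subset hx hFE
    · exact hsep.insert fun y hy _ => ⟨hfar y hy, by simpa only [dist_comm] using hfar y hy⟩
  have := le_csSup hbdd hmem
  omega

lemma boxBound_of_card_separated_le {E : Set X} {s C : ℝ} (hC : 0 < C)
    (h : ∀ ε : ℝ, 0 < ε → ε < 1 → ∀ F : Finset X, (F : Set X) ⊆ E →
      (F : Set X).Pairwise (fun x y => ε < dist x y) → (F.card : ℝ) ≤ C * ε ^ (-s)) :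
    BoxBound E s :=
  ⟨C, hC, fun ε h0 h1 => exists_finset_cover_of_card_separated_le h0.le (h ε h0 h1)⟩

end BoxBound

section FiniteDimensional

open MeasureTheory Module

variable {V : Type*} [NormedAddCommGroup V] [NormedSpace ℝ V]

lemma BoxBound.smul_image {A : Set V} {s : ℝ} (h : BoxBound A s) (c : ℝ) :
    BoxBound ((fun x => c • x) '' A) s :=
  h.image (lipschitzWith_smul c)

lemma exists_pow_mul_le_and_le_rpow {l M η : ℝ} (hl : 0 < l) (hl1 : l < 1) (hM : 0 < M)
    (hη : 0 < η) :
    ∃ D : ℝ, 0 < D ∧ ∀ ε : ℝ, 0 < ε → ε < 1 →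
      ∃ K : ℕ, l ^ K * M ≤ ε ∧ (K : ℝ) ≤ D * ε ^ (-η) := by
  have hδ : 0 < l ^ (-η) - 1 :=
    sub_pos.2 (Real.one_lt_rpow_of_pos_of_lt_one_of_neg hl hl1 (neg_lt_zero.2 hη))
  set δ := l ^ (-η) - 1 with hδ_def
  refine ⟨M ^ η / δ + 1, by positivity, fun ε h0 h1 => ?_⟩
  have hone : 1 ≤ ε ^ (-η) := Real.one_le_rpow_of_pos_of_le_one_of_nonpos h0 h1.le (by linarith)
  have hdiv : (M / ε) ^ η = M ^ η * ε ^ (-η) := by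
    rw [Real.div_rpow hM.le h0.le, Real.rpow_neg h0.le, div_eq_mul_inv]
  refine ⟨⌊(M / ε) ^ η / δ⌋₊ + 1, ?_, ?_⟩
  · set K := ⌊(M / ε) ^ η / δ⌋₊ + 1 with hK
    have hKδ : (M / ε) ^ η ≤ K * δ := by
      rw [← div_le_iff₀ hδ, hK]
      exact_mod_cast (Nat.lt_floor_add_one _).le
    have hbernoulli : 1 + K * δ ≤ (1 + δ) ^ K := one_add_mul_le_pow (by linarith) K
    have hpow : (M / ε) ^ η ≤ ((l ^ K)⁻¹) ^ η := by
      calc (M / ε) ^ η ≤ (1 + δ) ^ K := by linarith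
        _ = ((l ^ K)⁻¹) ^ η := by
            rw [hδ_def, add_sub_cancel, ← Real.rpow_natCast, ← Real.rpow_mul hl.le,
              ← Real.rpow_natCast, ← Real.rpow_neg hl.le, ← Real.rpow_mul hl.le]
            congr 1
            ring
    have hle := (Real.rpow_le_rpow_iff (by positivity) (by positivity) hη).1 hpow
    rwa [div_le_iff₀ h0, inv_mul_eq_div, le_div_iff₀ (by positivity), mul_comm] at hle
  · have hfloor : (⌊(M / ε) ^ η / δ⌋₊ : ℝ) ≤ M ^ η / δ * ε ^ (-η) :=
      (Nat.floor_le (by positivity)).trans_eq (by rw [hdiv]; ring)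
    push_cast
    linarith

lemma BoxBound.iUnion_pow_smul {A : Set V} {s s' l : ℝ} (h : BoxBound A s) (hs : 0 ≤ s)
    (hss : s < s') (hl : 0 < l) (hl1 : l < 1) :
    BoxBound (⋃ k : ℕ, (fun x => l ^ k • x) '' A) s' := by
  classical
  obtain ⟨M, hM, hAM⟩ := h.isBounded.exists_pos_norm_le
  obtain ⟨C, hC, hcover⟩ := h
  obtain ⟨D, hD, hK⟩ := exists_pow_mul_le_and_le_rpow hl hl1 hM (sub_pos.2 hss)
  refine ⟨D * C + 1, by positivity, fun ε h0 h1 => ?_⟩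
  obtain ⟨F, hF, hcov⟩ := hcover ε h0 h1
  obtain ⟨K, hKε, hKD⟩ := hK ε h0 h1
  refine ⟨insert 0 ((Finset.range K).biUnion fun k => F.image (l ^ k • ·)), ?_, ?_⟩
  · have hcard : (insert 0 ((Finset.range K).biUnion fun k => F.image (l ^ k • ·))).card ≤
        K * F.card + 1 := by
      refine (Finset.card_insert_le _ _).trans (Nat.add_le_add_right ?_ 1)
      simpa using Finset.card_biUnion_le_card_mul (Finset.range K) _ F.card
        fun k _ => Finset.card_image_le
    have hone : 1 ≤ ε ^ (-s') :=
      Real.one_le_rpow_of_pos_of_le_one_of_nonpos h0 h1.le (by linarith)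
    calc _ ≤ (K : ℝ) * F.card + 1 := by exact_mod_cast hcard
      _ ≤ (D * ε ^ (-(s' - s))) * (C * ε ^ (-s)) + ε ^ (-s') := by gcongr
      _ = (D * C + 1) * ε ^ (-s') := by
          rw [mul_mul_mul_comm, ← Real.rpow_add h0]
          ring_nf
  · intro x hx
    obtain ⟨k, a, ha, rfl⟩ := Set.mem_iUnion.1 hx
    rcases lt_or_ge k K with hk | hk
    · obtain ⟨y, hy, hay⟩ := hcov a ha
      refine ⟨l ^ k • y, Finset.mem_insert_of_mem (Finset.mem_biUnion.2
        ⟨k, Finset.mem_range.2 hk, Finset.mem_image_of_mem _ hy⟩), ?_⟩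
      rw [dist_smul₀, Real.norm_of_nonneg (by positivity)]
      exact (mul_le_of_le_one_left dist_nonneg (pow_le_one₀ hl.le hl1.le)).trans hay
    · refine ⟨0, Finset.mem_insert_self _ _, ?_⟩
      calc dist (l ^ k • a) 0 = l ^ k * ‖a‖ := by
            rw [dist_zero_right, norm_smul, Real.norm_of_nonneg (by positivity)]
        _ ≤ l ^ K * M := by
            have hpow : l ^ k ≤ l ^ K := pow_le_pow_of_le_one hl.le hl1.le hk
            gcongr
            exact hAM a ha
        _ ≤ ε := hKε

variable [FiniteDimensional ℝ V]

lemma pow_finrank_le_card_mul_of_cover {ρ ε : ℝ} (hρ : 0 < ρ) (hε : 0 ≤ ε) {F : Finset V}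
    (hcov : ∀ x : V, ‖x‖ < ρ → ∃ y ∈ F, dist x y ≤ ε) :
    ρ ^ finrank ℝ V ≤ F.card * ε ^ finrank ℝ V := by
  borelize V
  let μ : Measure V := Measure.addHaar
  have hunit : 0 < μ.real (Metric.ball 0 1) :=
    ENNReal.toReal_pos (Metric.measure_ball_pos μ 0 one_pos).ne' measure_ball_lt_top.ne
  have hsub : Metric.ball (0 : V) ρ ⊆ ⋃ y ∈ F, Metric.closedBall y ε := fun x hx => by
    simpa using hcov x (by simpa using hx)
  have hsum : μ.real (Metric.ball 0 ρ) ≤ ∑ y ∈ F, μ.real (Metric.closedBall y ε) :=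
    (measureReal_mono hsub (measure_biUnion_lt_top F.finite_toSet
      fun y _ => measure_closedBall_lt_top).ne).trans (measureReal_biUnion_finset_le F _)
  simp only [measureReal_def, Measure.addHaar_ball_of_pos μ _ hρ, Measure.addHaar_closedBall μ _ hε,
    ENNReal.toReal_mul, ENNReal.toReal_ofReal (pow_nonneg hρ.le _),
    ENNReal.toReal_ofReal (pow_nonneg hε _), Finset.sum_const, nsmul_eq_mul, ← mul_assoc] at hsum
  exact le_of_mul_le_mul_right hsum hunit

lemma card_mul_pow_finrank_le_of_separated {R ε : ℝ} (hR : 0 ≤ R) (hε : 0 < ε) {F : Finset V}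
    (hFR : (F : Set V) ⊆ Metric.closedBall 0 R)
    (hsep : (F : Set V).Pairwise (fun x y => ε < dist x y)) :
    F.card * (ε / 2) ^ finrank ℝ V ≤ (R + ε / 2) ^ finrank ℝ V := by
  borelize V
  let μ : Measure V := Measure.addHaar
  have hunit : 0 < μ.real (Metric.ball 0 1) :=
    ENNReal.toReal_pos (Metric.measure_ball_pos μ 0 one_pos).ne' measure_ball_lt_top.ne
  have hε2 : 0 < ε / 2 := by linarith
  have hRε : 0 ≤ R + ε / 2 := by linarith
  have hdisj : (F : Set V).PairwiseDisjoint fun x => Metric.ball x (ε / 2) :=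
    fun x hx y hy hxy => Metric.ball_disjoint_ball (by linarith [hsep hx hy hxy])
  have hsub : ⋃ x ∈ F, Metric.ball x (ε / 2) ⊆ Metric.closedBall (0 : V) (R + ε / 2) :=
    Set.iUnion₂_subset fun x hx => Metric.ball_subset_closedBall.trans <|
      Metric.closedBall_subset_closedBall' (by linarith [Metric.mem_closedBall.1 (hFR hx)])
  have hsum : ∑ x ∈ F, μ.real (Metric.ball x (ε / 2)) ≤
      μ.real (Metric.closedBall 0 (R + ε / 2)) := by
    rw [← measureReal_biUnion_finset hdisj (fun x _ => measurableSet_ball)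
      (fun x _ => measure_ball_lt_top.ne)]
    exact measureReal_mono hsub measure_closedBall_lt_top.ne
  simp only [measureReal_def, Measure.addHaar_ball_of_pos μ _ hε2,
    Measure.addHaar_closedBall μ _ hRε, ENNReal.toReal_mul,
    ENNReal.toReal_ofReal (pow_nonneg hε2.le _), ENNReal.toReal_ofReal (pow_nonneg hRε _),
    Finset.sum_const, nsmul_eq_mul, ← mul_assoc] at hsum
  exact le_of_mul_le_mul_right hsum hunit

lemma boxBound_closedBall (R : ℝ) : BoxBound (Metric.closedBall (0 : V) R) (finrank ℝ V) := by
  rcases lt_or_ge R 0 with hR | hR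
  · simpa [Metric.closedBall_eq_empty.2 hR] using boxBound_empty (X := V) _
  refine boxBound_of_card_separated_le (C := (2 * R + 1) ^ finrank ℝ V) (by positivity)
    fun ε h0 h1 F hFR hsep => ?_
  rw [Real.rpow_neg h0.le, Real.rpow_natCast, ← div_eq_mul_inv, le_div_iff₀ (by positivity)]
  have hvol := card_mul_pow_finrank_le_of_separated hR h0 hFR hsep
  rw [div_pow, mul_div_assoc', div_le_iff₀ (by positivity), ← mul_pow] at hvol
  refine hvol.trans (pow_le_pow_left₀ (by positivity) ?_ _)
  linarith

end FiniteDimensional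

section PackingDimension

variable {X : Type*} [PseudoMetricSpace X]

lemma exists_monotone_isClosed_boxBound_of_dimP_lt {E : Set X} {z : ℝ} (h : dimP E < z) :
    ∃ C : ℕ → Set X, Monotone C ∧ (∀ k, IsClosed (C k)) ∧ (∀ k, BoxBound (C k) z) ∧
      E ⊆ ⋃ k, C k := by
  obtain ⟨S, hS⟩ := iInf_lt_iff.1 h
  obtain ⟨hES, hz⟩ := iInf_lt_iff.1 hS
  have hbox (j : ℕ) : BoxBound (S j) z := boxBound_of_dimM_lt ((le_iSup _ j).trans_lt hz)
  refine ⟨fun k => ⋃ j ∈ Finset.range (k + 1), closure (S j), fun k l hkl => ?_, fun k => ?_,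
    fun k => .biUnion _ fun j _ => (hbox j).closure, fun x hx => ?_⟩
  · exact Set.biUnion_subset_biUnion_left fun j hj => by
      simp only [Finset.mem_coe, Finset.mem_range] at hj ⊢
      omega
  · exact (Finset.range (k + 1)).finite_toSet.isClosed_biUnion fun j _ => isClosed_closure
  · obtain ⟨j, hj⟩ := Set.mem_iUnion.1 (hES hx)
    exact Set.mem_iUnion.2 ⟨j, Set.mem_biUnion (by simp) (subset_closure hj)⟩

end PackingDimension

lemma exists_nonempty_inter_interior_closure {X ι : Type*} [TopologicalSpace X] [BaireSpace X]
    [Countable ι] {U : Set X} (hU : IsOpen U) (hne : U.Nonempty) {S : ι → Set X}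
    (hUS : U ⊆ ⋃ i, S i) : ∃ i, (U ∩ interior (closure (S i))).Nonempty := by
  have hcover : ⋃ o : Option ι, (o.elim Uᶜ fun i => closure (S i)) = Set.univ := by
    refine Set.eq_univ_of_forall fun x => Set.mem_iUnion.2 ?_
    by_cases hx : x ∈ U
    · obtain ⟨i, hi⟩ := Set.mem_iUnion.1 (hUS hx)
      exact ⟨some i, subset_closure hi⟩
    · exact ⟨none, hx⟩
  have hdense := dense_iUnion_interior_of_closed
    (fun o : Option ι => by cases o <;> simp [hU]) hcover
  obtain ⟨x, hxU, hx⟩ := hdense.inter_open_nonempty U hU hne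
  obtain ⟨o, ho⟩ := Set.mem_iUnion.1 hx
  cases o with
  | none => exact absurd hxU (interior_subset ho)
  | some i => exact ⟨i, x, hxU, ho⟩

/-! ### Progressions with prescribed differences -/

section Progressions

lemma ContainsAP.mono {R : Type*} [Semiring R] {k : ℕ} {d : R} {A A' : Set R}
    (h : ContainsAP k d A) (hA : A ⊆ A') : ContainsAP k d A' :=
  let ⟨a, ha⟩ := h
  ⟨a, fun i hi => hA (ha i hi)⟩

lemma ContainsAP.smul_image {R : Type*} [CommSemiring R] {k : ℕ} {d : R} {A : Set R}
    (h : ContainsAP k d A) (c : R) : ContainsAP k (c * d) ((fun x => c • x) '' A) := by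
  obtain ⟨a, ha⟩ := h
  exact ⟨c * a, fun i hi => ⟨a + i * d, ha i hi, by simp only [smul_eq_mul]; ring⟩⟩

lemma ContainsAP.exists_of_monotone {R : Type*} [Semiring R] {k : ℕ} {d : R} {C : ℕ → Set R}
    (hC : Monotone C) (h : ContainsAP k d (⋃ l, C l)) : ∃ l, ContainsAP k d (C l) := by
  classical
  obtain ⟨a, ha⟩ := h
  obtain ⟨l, hl⟩ := hC.directed_le.exists_mem_subset_of_finset_subset_biUnion
    (s := (Finset.range k).image fun i : ℕ => a + i * d) (by
      rw [Finset.coe_image, Set.image_subset_iff]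
      exact fun i hi => ha i (by simpa using hi))
  exact ⟨l, a, fun i hi => hl (by simpa using ⟨i, hi, rfl⟩)⟩

lemma containsAP_closure {R : Type*} [PseudoMetricSpace R] [ProperSpace R] [Semiring R]
    [ContinuousAdd R] [ContinuousMul R] {m : ℕ} (hm : 0 < m) {A T : Set R}
    (hA : Bornology.IsBounded A) (h : ∀ t ∈ T, ContainsAP m t A) {t : R} (ht : t ∈ closure T) :
    ContainsAP m t (closure A) := by
  obtain ⟨x, hxT, hx⟩ := mem_closure_iff_seq_limit.1 ht
  choose a ha using fun k => h (x k) (hxT k)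
  have ha0 (k : ℕ) : a k ∈ closure A := subset_closure (by simpa using ha k 0 hm)
  obtain ⟨b, -, φ, hφ, hb⟩ := hA.isCompact_closure.tendsto_subseq ha0
  refine ⟨b, fun i hi => ?_⟩
  exact isClosed_closure.mem_of_tendsto (hb.add ((hx.comp hφ.tendsto_atTop).const_mul (i : R)))
    (Eventually.of_forall fun k => subset_closure (ha (φ k) i hi))

lemma isAPSet_iUnion_pow_smul {m : ℕ} {A : Set ℝ} {l : ℝ} (hne : A.Nonempty) (hl : 0 < l)
    (hl1 : l < 1) (h : ∀ t ∈ Set.Icc l 1, ContainsAP m t A) :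
    IsAPSet m (⋃ k : ℕ, (fun x => l ^ k • x) '' A) := by
  intro t ht
  rcases ht.1.eq_or_lt with rfl | ht0
  · obtain ⟨a, ha⟩ := hne
    exact ⟨a, fun i _ => Set.mem_iUnion.2 ⟨0, a, ha, by simp⟩⟩
  · obtain ⟨k, hk, hk'⟩ := exists_nat_pow_near_of_lt_one ht0 ht.2 hl hl1
    have hlk : 0 < l ^ k := pow_pos hl k
    have hmem : t / l ^ k ∈ Set.Icc l 1 :=
      ⟨by rw [le_div_iff₀ hlk, ← pow_succ']; exact hk.le, by rwa [div_le_one hlk]⟩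
    have hAP := (h _ hmem).smul_image (l ^ k)
    rw [mul_div_cancel₀ _ hlk.ne'] at hAP
    exact hAP.mono (Set.subset_iUnion (fun k : ℕ => (fun x => l ^ k • x) '' A) k)

lemma fM_le_of_eventually {m : ℕ} {A : Set ℝ} {s t₀ : ℝ} (hA : BoxBound A s) (hne : A.Nonempty)
    (ht₀ : t₀ ≠ 0) (h : ∀ᶠ t in 𝓝 t₀, ContainsAP m t A) : fM m ≤ s := by
  have hnear : ∀ᶠ t in 𝓝 (1 : ℝ), ContainsAP m t ((fun x => t₀⁻¹ • x) '' A) := by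
    have hcont : Tendsto (fun t : ℝ => t₀ * t) (𝓝 1) (𝓝 t₀) := by
      simpa using (continuous_const_mul t₀).tendsto 1
    filter_upwards [hcont.eventually h] with t ht
    simpa [ht₀] using ht.smul_image t₀⁻¹
  obtain ⟨l, r, hlr, hsub⟩ := mem_nhds_iff_exists_Ioo_subset.1 (hnear.and (lt_mem_nhds one_pos))
  obtain ⟨l', hl', hl'1⟩ := exists_between hlr.1
  have hl'0 : 0 < l' := (hsub ⟨hl', hl'1.trans hlr.2⟩).2
  have hAP := isAPSet_iUnion_pow_smul (hne.image _) hl'0 hl'1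
    fun t ht => (hsub ⟨hl'.trans_le ht.1, ht.2.trans_lt hlr.2⟩).1
  have hs : 0 ≤ s := hA.nonneg hne
  refine EReal.le_of_forall_lt_iff_le.1 fun z hz => (iInf₂_le _ hAP).trans ?_
  have hz' : s < z := by exact_mod_cast hz
  exact ((hA.smul_image _).iUnion_pow_smul hs hz' hl'0 hl'1).dimM_le (hs.trans hz'.le)

lemma fM_le_of_somewhere_dense {m : ℕ} {A T : Set ℝ} {s : ℝ} (hs : 0 ≤ s) (hA : BoxBound A s)
    (hT : (interior (closure T)).Nonempty) (h : ∀ t ∈ T, ContainsAP m t A) : fM m ≤ s := by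
  rcases Nat.eq_zero_or_pos m with rfl | hm
  · have hempty : IsAPSet 0 ∅ := fun _ _ => ⟨0, fun i hi => absurd hi i.not_lt_zero⟩
    exact (iInf₂_le _ hempty).trans (by rw [dimM_empty]; exact_mod_cast hs)
  obtain ⟨t₀, ht₀, hne⟩ := (dense_compl_singleton (0 : ℝ)).inter_open_nonempty _
    isOpen_interior hT
  have hAP : ∀ᶠ t in 𝓝 t₀, ContainsAP m t (closure A) :=
    mem_of_superset (isOpen_interior.mem_nhds ht₀) fun t ht =>
      containsAP_closure hm hA.isBounded h (interior_subset ht)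
  obtain ⟨a, ha⟩ := hAP.self_of_nhds
  exact fM_le_of_eventually hA.closure ⟨_, ha 0 hm⟩ hne hAP

lemma fM_nonneg (m : ℕ) : 0 ≤ fM m :=
  le_iInf₂ fun A _ => dimM_nonneg A

lemma fP_le_fM (m : ℕ) : fP m ≤ fM m :=
  iInf₂_mono fun A _ => dimP_le_dimM A

lemma fM_le_fP (m : ℕ) : fM m ≤ fP m := by
  refine le_iInf₂ fun A hA => EReal.le_of_forall_lt_iff_le.1 fun z hz => ?_
  have hz0 : 0 ≤ z := by exact_mod_cast ((dimP_nonneg A).trans_lt hz).le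
  obtain ⟨C, hmono, -, hbox, hAC⟩ := exists_monotone_isClosed_boxBound_of_dimP_lt hz
  have hcover : Set.Ioo (0 : ℝ) 1 ⊆ ⋃ k, {t | ContainsAP m t (C k)} := fun t ht =>
    Set.mem_iUnion.2 (((hA t ⟨ht.1.le, ht.2.le⟩).mono hAC).exists_of_monotone hmono)
  obtain ⟨k, hk⟩ := exists_nonempty_inter_interior_closure isOpen_Ioo
    (Set.nonempty_Ioo.2 one_pos) hcover
  exact fM_le_of_somewhere_dense hz0 (hbox k) hk.right fun t ht => ht

lemma fM_eq_fP (m : ℕ) : fM m = fP m :=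
  le_antisymm (fM_le_fP m) (fP_le_fM m)

end Progressions

/-! ### Slices by parallel hyperplanes -/

section Slices

open Module

variable {E : Type*} [NormedAddCommGroup E] [InnerProductSpace ℝ E]

/-- The heights, measured in the direction `u`, at which `B` contains an `(n - 1)`-dimensional disc
of radius `ρ` orthogonal to `u`. They encode the facets of the homothets contained in `B`: a facet
with normal `u` contains such a disc, at a height determined by the centre and the ratio of the
homothet. -/
def discHeights (u : E) (ρ : ℝ) (B : Set E) : Set ℝ :=
  {c | ∃ p, inner ℝ u p = c ∧ ∀ w ∈ (ℝ ∙ u)ᗮ, ‖w‖ < ρ → p + w ∈ B}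

lemma discHeights_mono (u : E) {ρ ρ' : ℝ} {B B' : Set E} (hρ : ρ' ≤ ρ) (hB : B ⊆ B') :
    discHeights u ρ B ⊆ discHeights u ρ' B' :=
  fun _ ⟨p, hp, hdisc⟩ => ⟨p, hp, fun w hw hwρ => hB (hdisc w hw (hwρ.trans_le hρ))⟩

lemma inner_add_mul_mem_discHeights {u x : E} {c r ρ : ℝ} {P B : Set E} (hr : r ≠ 0)
    (hc : c ∈ discHeights u ρ P) (hB : ∀ y ∈ P, x + r • y ∈ B) :
    inner ℝ u x + r * c ∈ discHeights u (|r| * ρ) B := by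
  obtain ⟨p, rfl, hdisc⟩ := hc
  refine ⟨x + r • p, by rw [inner_add_right, inner_smul_right], fun w hw hwρ => ?_⟩
  have hmem := hB _ (hdisc (r⁻¹ • w) (Submodule.smul_mem _ _ hw) (by
    rwa [norm_smul, norm_inv, Real.norm_eq_abs, inv_mul_lt_iff₀ (abs_pos.2 hr)]))
  rwa [smul_add, smul_inv_smul₀ hr, ← add_assoc] at hmem

lemma exists_mem_discHeights_of_iUnion [CompleteSpace E] {ι : Type*} [Countable ι] {u : E}
    {c ρ : ℝ} (hρ : 0 < ρ) {C : ι → Set E} (hC : ∀ k, IsClosed (C k))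
    (hc : c ∈ discHeights u ρ (⋃ k, C k)) : ∃ k, ∃ ρ' > 0, c ∈ discHeights u ρ' (C k) := by
  obtain ⟨p, rfl, hdisc⟩ := hc
  let slice (k : ι) : Set (ℝ ∙ u)ᗮ := {w | p + w ∈ C k}
  have hclosed (k : ι) : IsClosed (slice k) := (hC k).preimage (by fun_prop)
  have hcover : Metric.ball (0 : (ℝ ∙ u)ᗮ) ρ ⊆ ⋃ k, slice k := fun w hw => by
    obtain ⟨k, hk⟩ := Set.mem_iUnion.1 (hdisc w w.2 (by simpa using hw))
    exact Set.mem_iUnion.2 ⟨k, hk⟩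
  obtain ⟨k, w₀, -, hw₀⟩ := exists_nonempty_inter_interior_closure Metric.isOpen_ball
    ⟨0, Metric.mem_ball_self hρ⟩ hcover
  rw [(hclosed k).closure_eq] at hw₀
  obtain ⟨ρ', hρ', hball⟩ := Metric.isOpen_iff.1 isOpen_interior w₀ hw₀
  have hperp : inner ℝ u (w₀ : E) = 0 := Submodule.mem_orthogonal_singleton_iff_inner_right.1 w₀.2
  refine ⟨k, ρ', hρ', p + w₀, by rw [inner_add_right, hperp, add_zero], fun w hw hwρ => ?_⟩
  have hmem : w₀ + ⟨w, hw⟩ ∈ slice k :=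
    interior_subset (hball (by simpa [dist_eq_norm] using hwρ))
  rw [add_assoc]
  exact hmem

lemma exists_mem_discHeights_of_convex [FiniteDimensional ℝ E] {u : E} {c : ℝ} {S : Set E}
    (hconv : Convex ℝ S) (hne : S.Nonempty) (hS : ∀ y ∈ S, inner ℝ u y = c)
    (hspan : (ℝ ∙ u)ᗮ ≤ vectorSpan ℝ S) : ∃ ρ > 0, c ∈ discHeights u ρ S := by
  obtain ⟨p, hp⟩ := Set.Nonempty.intrinsicInterior hconv hne
  have hpS : p ∈ S := intrinsicInterior_subset hp
  obtain ⟨p, hmem_int, rfl⟩ := mem_intrinsicInterior.1 hp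
  obtain ⟨ρ, hρ, hball⟩ := Metric.isOpen_iff.1 isOpen_interior p hmem_int
  refine ⟨ρ, hρ, p, hS p hpS, fun w hw hwρ => ?_⟩
  have hmem : w +ᵥ (p : E) ∈ affineSpan ℝ S :=
    AffineSubspace.vadd_mem_of_mem_direction
      (by rw [direction_affineSpan]; exact hspan hw) p.2
  have hdist : (⟨_, hmem⟩ : affineSpan ℝ S) ∈ Metric.ball p ρ := by
    rw [Metric.mem_ball, Subtype.dist_eq]
    simpa [dist_eq_norm] using hwρ
  rw [add_comm]
  exact (interior_subset (hball hdist) : (⟨_, hmem⟩ : affineSpan ℝ S) ∈ Subtype.val ⁻¹' S)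

lemma vectorSpan_le_orthogonal {u : E} {c : ℝ} {S : Set E} (hS : ∀ y ∈ S, inner ℝ u y = c) :
    vectorSpan ℝ S ≤ (ℝ ∙ u)ᗮ := by
  rw [vectorSpan_def, Submodule.span_le]
  rintro _ ⟨x, hx, y, hy, rfl⟩
  simp only [SetLike.mem_coe, Submodule.mem_orthogonal_singleton_iff_inner_right, vsub_eq_sub,
    inner_sub_right, hS x hx, hS y hy, sub_self]

lemma orthogonal_le_vectorSpan_of_mem_discHeights {u : E} {c ρ : ℝ} {S : Set E} (hρ : 0 < ρ)
    (hc : c ∈ discHeights u ρ S) : (ℝ ∙ u)ᗮ ≤ vectorSpan ℝ S := by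
  obtain ⟨p, -, hdisc⟩ := hc
  have hp : p ∈ S := by simpa using hdisc 0 (Submodule.zero_mem _) (by simpa using hρ)
  have small (w : E) (hw : w ∈ (ℝ ∙ u)ᗮ) (hwρ : ‖w‖ < ρ) : w ∈ vectorSpan ℝ S := by
    simpa using vsub_mem_vectorSpan ℝ (hdisc w hw hwρ) hp
  intro w hw
  have hpos : 0 < ρ / (‖w‖ + 1) := by positivity
  refine (Submodule.smul_mem_iff _ hpos.ne').1 (small _ (Submodule.smul_mem _ _ hw) ?_)
  rw [norm_smul, Real.norm_of_nonneg hpos.le, div_mul_eq_mul_div, div_lt_iff₀ (by positivity)]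
  nlinarith

variable [FiniteDimensional ℝ E]

lemma finrank_orthogonal_span_singleton_add_one {u : E} (hu : u ≠ 0) :
    finrank ℝ (ℝ ∙ u)ᗮ + 1 = finrank ℝ E := by
  rw [← finrank_span_singleton (K := ℝ) hu, add_comm, Submodule.finrank_add_finrank_orthogonal]

lemma nontrivial_orthogonal_span_singleton {u : E} (hu : u ≠ 0) (hE : 1 < finrank ℝ E) :
    Nontrivial (ℝ ∙ u)ᗮ :=
  finrank_pos_iff.1 (by linarith [finrank_orthogonal_span_singleton_add_one hu])

lemma vectorSpan_eq_orthogonal {u : E} (hu : u ≠ 0) {c : ℝ} {S : Set E}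
    (hS : ∀ y ∈ S, inner ℝ u y = c) (hrank : finrank ℝ (vectorSpan ℝ S) + 1 = finrank ℝ E) :
    vectorSpan ℝ S = (ℝ ∙ u)ᗮ :=
  Submodule.eq_of_le_of_finrank_eq (vectorSpan_le_orthogonal hS)
    (by linarith [finrank_orthogonal_span_singleton_add_one hu])

lemma cast_finrank_orthogonal_span_singleton {u : E} (hu : ‖u‖ = 1) :
    (finrank ℝ (ℝ ∙ u)ᗮ : ℝ) = (finrank ℝ E : ℝ) - 1 := by
  have hu0 : u ≠ 0 := norm_ne_zero_iff.1 (by rw [hu]; exact one_ne_zero)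
  rw [← finrank_orthogonal_span_singleton_add_one hu0]
  simp

lemma BoxBound.slab {u : E} (hu : ‖u‖ = 1) {S : Set ℝ} {s : ℝ} (hS : BoxBound S s) (R : ℝ) :
    BoxBound (Metric.closedBall 0 R ∩ {y : E | inner ℝ u y ∈ S})
      (s + ((finrank ℝ E : ℝ) - 1)) := by
  let f : ℝ × (ℝ ∙ u)ᗮ →L[ℝ] E :=
    (ContinuousLinearMap.toSpanSingleton ℝ u).coprod (ℝ ∙ u)ᗮ.subtypeL
  rw [← cast_finrank_orthogonal_span_singleton hu]
  refine ((hS.prod (boxBound_closedBall R)).image f.lipschitz).mono ?_ le_rfl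
  rintro y ⟨hyR, hyS⟩
  refine ⟨(inner ℝ u y, (ℝ ∙ u)ᗮ.orthogonalProjectionOnto y), ⟨hyS, ?_⟩, ?_⟩
  · rw [mem_closedBall_zero_iff] at hyR ⊢
    exact (Submodule.norm_orthogonalProjectionOnto_apply_le _ y).trans hyR
  · have hsum := Submodule.starProjection_add_starProjection_orthogonal (K := ℝ ∙ u) y
    rw [Submodule.starProjection_unit_singleton ℝ hu] at hsum
    simpa [f] using hsum

/-- The points of an `ε`-net close to the plane of the disc project to an `ε`-net of the disc. -/
lemma pow_finrank_le_card_filter_mul_of_cover {u p : E} (hu : ‖u‖ = 1) {ρ ε : ℝ} (hρ : 0 < ρ)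
    (hε : 0 ≤ ε) {F : Finset E}
    (hcov : ∀ w ∈ (ℝ ∙ u)ᗮ, ‖w‖ < ρ → ∃ y ∈ F, dist (p + w) y ≤ ε) :
    ρ ^ finrank ℝ (ℝ ∙ u)ᗮ ≤
      (F.filter fun y => dist (inner ℝ u y) (inner ℝ u p) ≤ ε).card *
        ε ^ finrank ℝ (ℝ ∙ u)ᗮ := by
  classical
  let π := (ℝ ∙ u)ᗮ.orthogonalProjectionOnto
  refine (pow_finrank_le_card_mul_of_cover hρ hε
    (F := (F.filter fun y => dist (inner ℝ u y) (inner ℝ u p) ≤ ε).image fun y => π (y - p))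
    fun w hw => ?_).trans ?_
  · obtain ⟨y, hy, hdist⟩ := hcov w w.2 hw
    refine ⟨π (y - p), Finset.mem_image_of_mem _ (Finset.mem_filter.2 ⟨hy, ?_⟩), ?_⟩
    · have hperp : inner ℝ u (w : E) = 0 :=
        Submodule.mem_orthogonal_singleton_iff_inner_right.1 w.2
      calc dist (inner ℝ u y) (inner ℝ u p) = |inner ℝ u (y - (p + w))| := by
            rw [Real.dist_eq, inner_sub_right, inner_add_right, hperp, add_zero]
        _ ≤ ‖u‖ * ‖y - (p + w)‖ := abs_real_inner_le_norm _ _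
        _ ≤ ε := by rwa [hu, one_mul, ← dist_eq_norm, dist_comm]
    · calc dist w (π (y - p)) = ‖π (p + w - y)‖ := by
            rw [dist_eq_norm, ← Submodule.orthogonalProjectionOnto_mem_subspace_eq_self w,
              ← map_sub]
            congr 2
            rw [Submodule.orthogonalProjectionOnto_mem_subspace_eq_self w]
            abel
        _ ≤ ‖p + w - y‖ := Submodule.norm_orthogonalProjectionOnto_apply_le _ _
        _ ≤ ε := by rwa [← dist_eq_norm]
  · gcongr
    exact_mod_cast Finset.card_image_le

lemma BoxBound.discHeights {u : E} (hu : ‖u‖ = 1) {ρ s : ℝ} (hρ : 0 < ρ) {B : Set E}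
    (hB : BoxBound B s) : BoxBound (discHeights u ρ B) (s - ((finrank ℝ E : ℝ) - 1)) := by
  classical
  set k := finrank ℝ (ℝ ∙ u)ᗮ
  obtain ⟨C, hC, hcover⟩ := hB.exists_cover_div one_le_two
  refine boxBound_of_card_separated_le (C := C / ρ ^ k) (by positivity)
    fun ε h0 h1 Q hQ hsep => ?_
  obtain ⟨F, hF, hcov⟩ := hcover ε h0 h1
  let near (c : ℝ) : Finset E := F.filter fun y => dist (inner ℝ u y) c ≤ ε / 2
  have hdisj : (Q : Set ℝ).PairwiseDisjoint near := fun a ha b hb hab =>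
    Finset.disjoint_left.2 fun y hya hyb => by
      have hya' := (Finset.mem_filter.1 hya).2
      have hyb' := (Finset.mem_filter.1 hyb).2
      linarith [hsep ha hb hab, dist_triangle_left a b (inner ℝ u y)]
  have hnear : ∀ c ∈ Q, ρ ^ k ≤ (near c).card * ε ^ k := fun c hc => by
    obtain ⟨p, rfl, hdisc⟩ := hQ hc
    refine (pow_finrank_le_card_filter_mul_of_cover hu hρ (by positivity)
      fun w hw hwρ => hcov _ (hdisc w hw hwρ)).trans ?_
    gcongr
    linarith
  have hcount : Q.card * ρ ^ k ≤ F.card * ε ^ k := by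
    calc Q.card * ρ ^ k = ∑ _c ∈ Q, ρ ^ k := by simp
      _ ≤ ∑ c ∈ Q, ((near c).card : ℝ) * ε ^ k := Finset.sum_le_sum hnear
      _ = ((Q.biUnion near).card : ℝ) * ε ^ k := by
          rw [Finset.card_biUnion hdisj, Nat.cast_sum, Finset.sum_mul]
      _ ≤ F.card * ε ^ k := by
          gcongr
          exact Finset.biUnion_subset.2 fun c _ => Finset.filter_subset _ _
  calc (Q.card : ℝ) ≤ F.card * ε ^ k / ρ ^ k := by rwa [le_div_iff₀ (by positivity)]
    _ ≤ C * ε ^ (-s) * ε ^ k / ρ ^ k := by gcongr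
    _ = C / ρ ^ k * ε ^ (-(s - ((finrank ℝ E : ℝ) - 1))) := by
        rw [← cast_finrank_orthogonal_span_singleton hu, neg_sub, sub_eq_neg_add,
          Real.rpow_add h0, Real.rpow_natCast]
        ring

end Slices

/-! ### Faces of a polytope -/

section Body

variable {n s : ℕ} {u : Fin s → EuclideanSpace ℝ (Fin n)} {d : Fin s → ℝ}

lemma body_eq_iInter (u : Fin s → EuclideanSpace ℝ (Fin n)) (d : Fin s → ℝ) :
    body u d = ⋂ i, {y | inner ℝ (u i) y ≤ d i} := by
  ext
  simp [body]

lemma isClosed_body : IsClosed (body u d) := by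
  rw [body_eq_iInter]
  exact isClosed_iInter fun i => isClosed_le (by fun_prop) (by fun_prop)

lemma convex_body : Convex ℝ (body u d) := by
  rw [body_eq_iInter]
  exact convex_iInter fun i => convex_halfSpace_le (innerₛₗ ℝ (u i)).isLinear (d i)

lemma mem_interior_body {y : EuclideanSpace ℝ (Fin n)} (h : ∀ i, inner ℝ (u i) y < d i) :
    y ∈ interior (body u d) := by
  have hopen : IsOpen (⋂ i, {y | inner ℝ (u i) y < d i}) :=
    isOpen_iInter_of_finite fun i => isOpen_lt (by fun_prop) (by fun_prop)
  exact interior_maximal (fun z hz i => (Set.mem_iInter.1 hz i).le) hopen (Set.mem_iInter.2 h)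

lemma mem_body_and_exists_eq_of_mem_frontier {y : EuclideanSpace ℝ (Fin n)}
    (h : y ∈ frontier (body u d)) : y ∈ body u d ∧ ∃ i, inner ℝ (u i) y = d i := by
  have hy : y ∈ body u d := isClosed_body.frontier_subset h
  refine ⟨hy, ?_⟩
  by_contra! hne
  exact h.2 (mem_interior_body fun i => (hy i).lt_of_ne (hne i))

lemma inner_lt_of_mem_interior_body {y : EuclideanSpace ℝ (Fin n)}
    (h : y ∈ interior (body u d)) {i : Fin s} (hu : ‖u i‖ = 1) : inner ℝ (u i) y < d i := by
  obtain ⟨ε, hε, hball⟩ := Metric.isOpen_iff.1 isOpen_interior y h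
  have hmem : y + (ε / 2) • u i ∈ body u d := interior_subset (hball (by
    rw [Metric.mem_ball, dist_eq_norm, add_sub_cancel_left, norm_smul, hu,
      Real.norm_of_nonneg (by linarith)]
    linarith))
  have hle := hmem i
  rw [inner_add_right, inner_smul_right, real_inner_self_eq_norm_sq, hu] at hle
  linarith

lemma mem_frontier_body_of_eq {y : EuclideanSpace ℝ (Fin n)} (hy : y ∈ body u d) {i : Fin s}
    (hu : ‖u i‖ = 1) (h : inner ℝ (u i) y = d i) : y ∈ frontier (body u d) :=
  ⟨subset_closure hy, fun hmem_int => (inner_lt_of_mem_interior_body hmem_int hu).ne h⟩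

variable {P : Set (EuclideanSpace ℝ (Fin n))}

lemma IsPolytopeWith.normal_ne_zero (h : IsPolytopeWith u d P) (i : Fin s) : u i ≠ 0 :=
  norm_ne_zero_iff.1 (by rw [h.norm_normal i]; exact one_ne_zero)

lemma IsPolytopeWith.nonempty_faces [NeZero n] (h : IsPolytopeWith u d P) : Nonempty (Fin s) := by
  by_contra hempty
  rw [not_nonempty_iff] at hempty
  have huniv : body u d = Set.univ := Set.eq_univ_of_forall fun y i => isEmptyElim i
  have : Nontrivial (EuclideanSpace ℝ (Fin n)) := ⟨EuclideanSpace.single 0 1, 0, by simp⟩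
  exact NormedSpace.unbounded_univ ℝ (EuclideanSpace ℝ (Fin n)) (huniv ▸ h.bounded)

lemma IsPolytopeWith.exists_mem_discHeights (hn : 1 < n) (h : IsPolytopeWith u d P) (i : Fin s) :
    ∃ ρ > 0, d i ∈ discHeights (u i) ρ P := by
  let face := body u d ∩ hyperplane (u i) (d i)
  have hplane : ∀ y ∈ face, inner ℝ (u i) y = d i := fun y hy => hy.2
  have hrank : Module.finrank ℝ (vectorSpan ℝ face) + 1 = n := h.facet i
  have hconv : Convex ℝ face :=
    convex_body.inter (convex_hyperplane (innerₛₗ ℝ (u i)).isLinear (d i))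
  have hne : face.Nonempty := by
    by_contra hempty
    rw [Set.not_nonempty_iff_eq_empty.1 hempty, vectorSpan_empty, finrank_bot] at hrank
    omega
  obtain ⟨ρ, hρ, hmem⟩ := exists_mem_discHeights_of_convex hconv hne hplane
    (vectorSpan_eq_orthogonal (h.normal_ne_zero i) hplane (by simpa using hrank)).ge
  have hface : face ⊆ P := fun y hy =>
    h.eq_frontier ▸ mem_frontier_body_of_eq hy.1 (h.norm_normal i) hy.2
  exact ⟨ρ, hρ, discHeights_mono _ le_rfl hface hmem⟩

lemma IsPolytopeWith.exists_forall_mem_discHeights (hn : 1 < n) (h : IsPolytopeWith u d P)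
    {C : ℕ → Set (EuclideanSpace ℝ (Fin n))} (hmono : Monotone C) (hC : ∀ k, IsClosed (C k))
    {x : EuclideanSpace ℝ (Fin n)} {r : ℝ} (hr : r ≠ 0) (hx : ∀ y ∈ P, x + r • y ∈ ⋃ k, C k) :
    ∃ k l : ℕ, ∀ i, inner ℝ (u i) x + r * d i ∈ discHeights (u i) (1 / ((l : ℝ) + 1)) (C k) := by
  have single_face (i : Fin s) : ∃ k l : ℕ,
      inner ℝ (u i) x + r * d i ∈ discHeights (u i) (1 / ((l : ℝ) + 1)) (C k) := by
    obtain ⟨ρ, hρ, hd⟩ := h.exists_mem_discHeights hn i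
    obtain ⟨k, ρ', hρ', hmem⟩ := exists_mem_discHeights_of_iUnion
      (mul_pos (abs_pos.2 hr) hρ) hC (inner_add_mul_mem_discHeights hr hd hx)
    obtain ⟨l, hl⟩ := exists_nat_one_div_lt hρ'
    exact ⟨k, l, discHeights_mono _ hl.le subset_rfl hmem⟩
  choose k l hkl using single_face
  refine ⟨Finset.univ.sup k, Finset.univ.sup l, fun i => discHeights_mono _ ?_ ?_ (hkl i)⟩
  · gcongr
    exact Finset.le_sup (Finset.mem_univ i)
  · exact hmono (Finset.le_sup (Finset.mem_univ i))

end Body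

/-! ### Homothets centred on the unit segment -/

section UnitSegment

variable {n : ℕ} [NeZero n]

lemma inner_of_mem_unitSegment {x : EuclideanSpace ℝ (Fin n)} (hx : x ∈ unitSegment n)
    (v : EuclideanSpace ℝ (Fin n)) : inner ℝ v x = x 0 * v 0 := by
  rw [PiLp.inner_apply, Finset.sum_eq_single 0 (fun i _ hi => by simp [hx.2 i hi]) (by simp)]
  simp

lemma norm_le_one_of_mem_unitSegment {x : EuclideanSpace ℝ (Fin n)} (hx : x ∈ unitSegment n) :
    ‖x‖ ≤ 1 := by
  have hsq := inner_of_mem_unitSegment hx x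
  rw [real_inner_self_eq_norm_sq] at hsq
  nlinarith [norm_nonneg x, hx.1.1, hx.1.2]

lemma single_mem_unitSegment {t : ℝ} (ht : t ∈ Set.Icc (0 : ℝ) 1) :
    EuclideanSpace.single (0 : Fin n) t ∈ unitSegment n :=
  ⟨by simpa using ht, fun i hi => by simp [hi]⟩

end UnitSegment

lemma leastDimP_le_leastDimM {n : ℕ} (P S : Set (EuclideanSpace ℝ (Fin n))) :
    leastDimP P S ≤ leastDimM P S :=
  iInf₂_mono fun B _ => dimP_le_dimM B

lemma IsAPSet.exists_start_ne {m : ℕ} {A : Set ℝ} (hA : IsAPSet m A) {t : ℝ}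
    (ht : t ∈ Set.Icc (0 : ℝ) 1) (c : ℝ) :
    ∃ b ≠ c, ∀ l : ℕ, l < m → b + l * t ∈ A ∪ (fun x => x + 1) '' A := by
  obtain ⟨b, hb⟩ := hA t ht
  by_cases hbc : b = c
  · exact ⟨b + 1, by simp [hbc], fun l hl => Or.inr ⟨b + l * t, hb l hl, by ring⟩⟩
  · exact ⟨b, hbc, fun l hl => Or.inl (hb l hl)⟩

section Harmonic

variable {n s m : ℕ} [NeZero n] {u : Fin s → EuclideanSpace ℝ (Fin n)} {d j : Fin s → ℝ}
  {P : Set (EuclideanSpace ℝ (Fin n))}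

/-- A homothet with centre `t • e₁` and ratio `r` has its faces at the heights
`d i * (t * j i + r)`, so after division by `d i` they form a progression of difference `t * q`. -/
lemma IsHarmonic.inner_add_mul (hH : IsHarmonic u d j m) {x : EuclideanSpace ℝ (Fin n)}
    (hx : x ∈ unitSegment n) (r : ℝ) (i : Fin s) :
    inner ℝ (u i) x + r * d i = d i * (x 0 * j i + r) := by
  rw [inner_of_mem_unitSegment hx, ← hH.first_coord i]
  ring

lemma exists_containsHomothets (hPoly : IsPolytopeWith u d P) (hH : IsHarmonic u d j m)
    {A : Set ℝ} {t : ℝ} (hA : IsAPSet m A) (hAt : BoxBound A t) :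
    ∃ B, ContainsHomothets P (unitSegment n) B ∧ BoxBound B (t + ((n : ℝ) - 1)) := by
  obtain ⟨a, q, hq, hlabels⟩ := hH.progression
  let A' := A ∪ (fun x => x + 1) '' A
  have hA't : BoxBound A' t :=
    hAt.union (hAt.image (IsometryEquiv.addRight (1 : ℝ)).isometry.lipschitz)
  obtain ⟨M, hM, hA'M⟩ := hA't.isBounded.exists_pos_norm_le
  obtain ⟨M', -, hKM'⟩ := hPoly.bounded.exists_pos_norm_le
  let R := 1 + (|q| * M + |a|) * M'
  let slab (i : Fin s) := Metric.closedBall 0 R ∩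
    {y | inner ℝ (u i) y ∈ (fun x => (d i * q) • x) '' A'}
  refine ⟨⋃ i, slab i, fun x hx => ?_, BoxBound.iUnion fun i => ?_⟩
  · obtain ⟨b, hb, hbA'⟩ := hA.exists_start_ne hx.1 (x 0 * a / q)
    refine ⟨q * b - x 0 * a, fun h0 => hb ?_, fun y hy => ?_⟩
    · rw [eq_div_iff hq]
      linarith
    obtain ⟨hyK, i, hi⟩ := mem_body_and_exists_eq_of_mem_frontier (hPoly.eq_frontier ▸ hy)
    obtain ⟨l, hl, hjl⟩ := hlabels.subset (Set.mem_range_self i)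
    refine Set.mem_iUnion.2 ⟨i, ?_, b + l * x 0, hbA' l hl, ?_⟩
    · have hbM : |b| ≤ M := by simpa using hA'M _ (hbA' 0 (by omega))
      have hratio : |q * b - x 0 * a| ≤ |q| * M + |a| := by
        refine (abs_sub _ _).trans ?_
        rw [abs_mul, abs_mul, abs_of_nonneg hx.1.1]
        gcongr
        exact mul_le_of_le_one_left (abs_nonneg a) hx.1.2
      rw [mem_closedBall_zero_iff]
      refine (norm_add_le _ _).trans
        (add_le_add (norm_le_one_of_mem_unitSegment hx) ((norm_smul _ _).trans_le ?_))
      exact mul_le_mul hratio (hKM' y hyK) (norm_nonneg _) (by positivity)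
    · simp only [inner_add_right, inner_smul_right, hi, hH.inner_add_mul hx, hjl, smul_eq_mul]
      ring
  · simpa only [finrank_euclideanSpace_fin] using
      (hA't.smul_image (d i * q)).slab (hPoly.norm_normal i) R

lemma hM_le (hPoly : IsPolytopeWith u d P) (hH : IsHarmonic u d j m) :
    hM P ≤ (((n : ℝ) - 1 : ℝ) : EReal) + fM m := by
  have hn : (1 : ℝ) ≤ n := by exact_mod_cast NeZero.one_le
  have hbot : (((n : ℝ) - 1 : ℝ) : EReal) ≠ ⊥ := EReal.coe_ne_bot _
  have htop : (((n : ℝ) - 1 : ℝ) : EReal) ≠ ⊤ := EReal.coe_ne_top _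
  rw [add_comm, ← EReal.sub_le_iff_le_add (Or.inl hbot) (Or.inl htop)]
  refine le_iInf₂ fun A hA => EReal.le_of_forall_lt_iff_le.1 fun z hz => ?_
  have hz0 : 0 ≤ z := by exact_mod_cast ((dimM_nonneg A).trans_lt hz).le
  obtain ⟨B, hB, hBz⟩ := exists_containsHomothets hPoly hH hA (boxBound_of_dimM_lt hz)
  rw [EReal.sub_le_iff_le_add (Or.inl hbot) (Or.inl htop), ← EReal.coe_add]
  exact (iInf₂_le B hB).trans (hBz.dimM_le (by linarith))

lemma exists_containsAP_of_discHeights (hu : ∀ i, ‖u i‖ = 1) (hH : IsHarmonic u d j m) {ρ z : ℝ}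
    (hρ : 0 < ρ) {C : Set (EuclideanSpace ℝ (Fin n))} (hC : BoxBound C z) :
    ∃ A : Set ℝ, BoxBound A (z - ((n : ℝ) - 1)) ∧ ∀ t r : ℝ,
      (∀ i, d i * (t * j i + r) ∈ discHeights (u i) ρ C) → ContainsAP m t A := by
  obtain ⟨a, q, hq, hlabels⟩ := hH.progression
  let A := ⋃ i, (fun x => (d i)⁻¹ • x) '' discHeights (u i) ρ C
  have hA : BoxBound A (z - ((n : ℝ) - 1)) := BoxBound.iUnion fun i => by
    simpa using (hC.discHeights (hu i) hρ).smul_image (d i)⁻¹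
  refine ⟨_, hA.smul_image q⁻¹, fun t r htr => ?_⟩
  have hAP : ContainsAP m (q * t) A := by
    refine ⟨t * a + r, fun l hl => ?_⟩
    obtain ⟨i, hi⟩ := hlabels.superset ⟨l, hl, rfl⟩
    refine Set.mem_iUnion.2 ⟨i, d i * (t * j i + r), htr i, ?_⟩
    simp only [smul_eq_mul]
    rw [inv_mul_cancel_left₀ (hH.dist_ne_zero i), hi]
    ring
  simpa [hq] using hAP.smul_image q⁻¹

lemma le_hP (hn : 1 < n) (hPoly : IsPolytopeWith u d P) (hH : IsHarmonic u d j m) :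
    (((n : ℝ) - 1 : ℝ) : EReal) + fM m ≤ hP P := by
  refine le_iInf₂ fun B hB => EReal.le_of_forall_lt_iff_le.1 fun z hz => ?_
  obtain ⟨C, hmono, hclosed, hbox, hBC⟩ := exists_monotone_isClosed_boxBound_of_dimP_lt hz
  let T (c : ℕ × ℕ) : Set ℝ :=
    {t | ∃ r, ∀ i, d i * (t * j i + r) ∈ discHeights (u i) (1 / ((c.2 : ℝ) + 1)) (C c.1)}
  have hcover : Set.Ioo (0 : ℝ) 1 ⊆ ⋃ c, T c := fun t ht => by
    have hx := single_mem_unitSegment (n := n) (Set.Ioo_subset_Icc_self ht)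
    obtain ⟨r, hr, hrB⟩ := hB _ hx
    obtain ⟨k, l, hkl⟩ := hPoly.exists_forall_mem_discHeights hn hmono hclosed hr
      fun y hy => hBC (hrB y hy)
    refine Set.mem_iUnion.2 ⟨(k, l), r, fun i => ?_⟩
    simpa [hH.inner_add_mul hx] using hkl i
  obtain ⟨⟨k, l⟩, hne⟩ := exists_nonempty_inter_interior_closure isOpen_Ioo
    (Set.nonempty_Ioo.2 one_pos) hcover
  have hT : (interior (closure (T (k, l)))).Nonempty := hne.mono Set.inter_subset_right
  have hρ : 0 < 1 / ((l : ℝ) + 1) := by positivity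
  obtain ⟨A, hA, hAP⟩ := exists_containsAP_of_discHeights hPoly.norm_normal hH hρ (hbox k)
  have hz0 : 0 ≤ z - ((n : ℝ) - 1) := by
    obtain ⟨i⟩ := hPoly.nonempty_faces
    obtain ⟨t, r, htr⟩ := closure_nonempty_iff.1 (hT.mono interior_subset)
    simpa using ((hbox k).discHeights (hPoly.norm_normal i) hρ).nonneg ⟨_, htr i⟩
  calc (((n : ℝ) - 1 : ℝ) : EReal) + fM m
      ≤ (((n : ℝ) - 1 : ℝ) : EReal) + ((z - ((n : ℝ) - 1) : ℝ) : EReal) := by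
        gcongr
        exact fM_le_of_somewhere_dense hz0 hA hT fun t ⟨r, htr⟩ => hAP t r htr
    _ = z := by rw [← EReal.coe_add, add_sub_cancel]

lemma hM_eq (hn : 1 < n) (hPoly : IsPolytopeWith u d P) (hH : IsHarmonic u d j m) :
    hM P = (((n : ℝ) - 1 : ℝ) : EReal) + fM m :=
  le_antisymm (hM_le hPoly hH) ((le_hP hn hPoly hH).trans (leastDimP_le_leastDimM _ _))

lemma hP_eq (hn : 1 < n) (hPoly : IsPolytopeWith u d P) (hH : IsHarmonic u d j m) :
    hP P = (((n : ℝ) - 1 : ℝ) : EReal) + fM m :=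
  le_antisymm ((leastDimP_le_leastDimM _ _).trans (hM_le hPoly hH)) (le_hP hn hPoly hH)

end Harmonic

/-! ### Numbers with restricted digits -/

section SelfSimilar

variable {X ι : Type*} [PseudoMetricSpace X] {E : Set X} {I : Finset ι} {f : ι → X → X} {c : ℝ≥0}

lemma exists_cover_pow_of_subset_biUnion_image (hf : ∀ i ∈ I, LipschitzWith c (f i))
    (hE : E ⊆ ⋃ i ∈ I, f i '' E) {D : ℝ} (hD : ∀ x ∈ E, ∀ y ∈ E, dist x y ≤ D) (J : ℕ) :
    ∃ F : Finset X, F.card ≤ I.card ^ J ∧ ∀ x ∈ E, ∃ y ∈ F, dist x y ≤ (c : ℝ) ^ J * D := by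
  classical
  induction J with
  | zero =>
    rcases E.eq_empty_or_nonempty with rfl | ⟨y, hy⟩
    · exact ⟨∅, by simp, by simp⟩
    · exact ⟨{y}, by simp, fun x hx => ⟨y, by simp, by simpa using hD x hx y hy⟩⟩
  | succ J ih =>
    obtain ⟨F, hF, hcov⟩ := ih
    refine ⟨(I ×ˢ F).image fun q => f q.1 q.2, ?_, fun x hx => ?_⟩
    · calc _ ≤ (I ×ˢ F).card := Finset.card_image_le
        _ = I.card * F.card := Finset.card_product I F
        _ ≤ I.card * I.card ^ J := by gcongr
        _ = I.card ^ (J + 1) := (pow_succ' _ _).symm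
    · obtain ⟨i, hi, x', hx', rfl⟩ := Set.mem_iUnion₂.1 (hE hx)
      obtain ⟨y, hy, hxy⟩ := hcov x' hx'
      refine ⟨f i y, Finset.mem_image.2 ⟨(i, y), Finset.mk_mem_product hi hy, rfl⟩, ?_⟩
      calc dist (f i x') (f i y) ≤ c * dist x' y := (hf i hi).dist_le_mul x' y
        _ ≤ c * ((c : ℝ) ^ J * D) := by gcongr
        _ = (c : ℝ) ^ (J + 1) * D := by ring

lemma boxBound_of_subset_biUnion_image (hc0 : 0 < c) (hc1 : c < 1)
    (hf : ∀ i ∈ I, LipschitzWith c (f i)) (hE : E ⊆ ⋃ i ∈ I, f i '' E)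
    (hbdd : Bornology.IsBounded E) : BoxBound E (Real.logb (c : ℝ)⁻¹ I.card) := by
  rcases I.eq_empty_or_nonempty with rfl | hI
  · rw [Set.subset_eq_empty hE (by simp)]
    exact boxBound_empty _
  obtain ⟨D₀, hD₀⟩ := Metric.isBounded_iff.1 hbdd
  set D := max D₀ 1
  have hD1 : 1 ≤ D := le_max_right _ _
  have hcard : (1 : ℝ) ≤ I.card := by exact_mod_cast hI.card_pos
  have hc0' : (0 : ℝ) < c := by exact_mod_cast hc0
  have hcinv : 1 < (c : ℝ)⁻¹ := (one_lt_inv₀ hc0').2 (by exact_mod_cast hc1)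
  set s := Real.logb (c : ℝ)⁻¹ I.card
  have hs : 0 ≤ s := Real.logb_nonneg hcinv hcard
  refine ⟨I.card * D ^ s, by positivity, fun ε h0 h1 => ?_⟩
  obtain ⟨J, hJlt, hleJ⟩ := exists_nat_pow_near_of_lt_one (div_pos h0 (by positivity))
    ((div_le_one (by positivity)).2 (h1.le.trans hD1)) hc0' (by exact_mod_cast hc1)
  obtain ⟨F, hF, hcov⟩ := exists_cover_pow_of_subset_biUnion_image hf hE
    (fun x hx y hy => (hD₀ hx hy).trans (le_max_left _ 1)) (J + 1)
  refine ⟨F, ?_, fun x hx => ?_⟩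
  · have hpow : (I.card : ℝ) ^ J ≤ (ε / D) ^ (-s) := by
      calc (I.card : ℝ) ^ J = (((c : ℝ)⁻¹) ^ s) ^ J := by
            rw [Real.rpow_logb (by positivity) hcinv.ne' (by positivity)]
        _ = ((c : ℝ) ^ J) ^ (-s) := by
            rw [Real.inv_rpow hc0'.le, ← Real.rpow_neg hc0'.le, Real.rpow_pow_comm hc0'.le]
        _ ≤ (ε / D) ^ (-s) :=
            Real.rpow_le_rpow_of_nonpos (by positivity) hleJ (neg_nonpos.2 hs)
    calc (F.card : ℝ) ≤ (I.card : ℝ) ^ (J + 1) := by exact_mod_cast hF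
      _ = I.card * (I.card : ℝ) ^ J := pow_succ' _ _
      _ ≤ I.card * (ε / D) ^ (-s) := by gcongr
      _ = I.card * D ^ s * ε ^ (-s) := by
          rw [Real.div_rpow h0.le (by positivity), Real.rpow_neg (by positivity : 0 ≤ D),
            div_inv_eq_mul]
          ring
  · obtain ⟨y, hy, hxy⟩ := hcov x hx
    exact ⟨y, hy, hxy.trans ((lt_div_iff₀ (by positivity)).1 hJlt).le⟩

end SelfSimilar

section DigitSums

/-- The real numbers whose expansion `∑ a i / N ^ (i + 1)` in base `N` can be written with digits
`a i ∈ A`, where the digits are arbitrary integers. This self-similar set turns progressions in `A`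
with the differences `0, …, N - 1` into progressions with all differences in `[0, 1]`. -/
def digitSums (A : Finset ℤ) (N : ℕ) : Set ℝ :=
  {x | ∃ a : ℕ → ℤ, (∀ i, a i ∈ A) ∧ HasSum (fun i => (a i : ℝ) / (N : ℝ) ^ (i + 1)) x}

variable {A : Finset ℤ} {N : ℕ}

lemma summable_const_div_pow_succ (hN : 1 < N) (M : ℝ) :
    Summable fun i : ℕ => M / (N : ℝ) ^ (i + 1) := by
  simpa only [mul_one_div, one_div_pow] using (summable_nat_add_iff 1).2
    ((summable_geometric_of_lt_one (by positivity)
      ((div_lt_one (by positivity)).2 (Nat.one_lt_cast.2 hN) : 1 / (N : ℝ) < 1)).mul_left M)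

lemma exists_norm_div_pow_succ_le (A : Finset ℤ) (N : ℕ) : ∃ M : ℝ, ∀ a : ℕ → ℤ,
    (∀ i, a i ∈ A) → ∀ i, ‖(a i : ℝ) / (N : ℝ) ^ (i + 1)‖ ≤ M / (N : ℝ) ^ (i + 1) := by
  obtain ⟨M, hM⟩ := (A.finite_toSet.image fun a : ℤ => ‖(a : ℝ)‖).bddAbove
  refine ⟨M, fun a ha i => ?_⟩
  rw [norm_div, norm_pow, Real.norm_natCast]
  gcongr
  exact hM (Set.mem_image_of_mem _ (ha i))

lemma summable_digits (hN : 1 < N) {a : ℕ → ℤ} (ha : ∀ i, a i ∈ A) :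
    Summable fun i => (a i : ℝ) / (N : ℝ) ^ (i + 1) :=
  let ⟨M, hM⟩ := exists_norm_div_pow_succ_le A N
  (summable_const_div_pow_succ hN M).of_norm_bounded (hM a ha)

lemma isBounded_digitSums (hN : 1 < N) (A : Finset ℤ) : Bornology.IsBounded (digitSums A N) := by
  obtain ⟨M, hM⟩ := exists_norm_div_pow_succ_le A N
  refine isBounded_iff_forall_norm_le.2 ⟨∑' i : ℕ, M / (N : ℝ) ^ (i + 1),
    fun x ⟨a, ha, hsum⟩ => ?_⟩
  exact hsum.norm_le_of_bounded (summable_const_div_pow_succ hN M).hasSum (hM a ha)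

lemma digitSums_subset_biUnion_image (hN : N ≠ 0) (A : Finset ℤ) :
    digitSums A N ⊆ ⋃ a ∈ A, (fun x : ℝ => ((a : ℝ) + x) / N) '' digitSums A N := by
  rintro x ⟨a, ha, hsum⟩
  have hN0 : (N : ℝ) ≠ 0 := Nat.cast_ne_zero.2 hN
  have htail : HasSum (fun i => (a (i + 1) : ℝ) / (N : ℝ) ^ (i + 1)) (N * x - a 0) := by
    convert! ((hasSum_nat_add_iff' 1).2 hsum).mul_left (N : ℝ) using 1
    · ext i
      field_simp
      ring
    · rw [Finset.sum_range_one]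
      field_simp
      ring
  refine Set.mem_iUnion₂.2 ⟨a 0, ha 0, _, ⟨fun i => a (i + 1), fun i => ha _, htail⟩, ?_⟩
  simp only [add_sub_cancel]
  field_simp

lemma boxBound_digitSums (hN : 1 < N) (A : Finset ℤ) :
    BoxBound (digitSums A N) (Real.logb N A.card) := by
  have hN0 : N ≠ 0 := by omega
  have hlip (a : ℤ) : LipschitzWith (N : ℝ≥0)⁻¹ fun x : ℝ => ((a : ℝ) + x) / N :=
    LipschitzWith.of_dist_le_mul fun x y => le_of_eq (by
      rw [Real.dist_eq, Real.dist_eq, ← sub_div, add_sub_add_left_eq_sub, abs_div, Nat.abs_cast]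
      simp [div_eq_inv_mul])
  simpa using boxBound_of_subset_biUnion_image (by positivity)
    (inv_lt_one_of_one_lt₀ (Nat.one_lt_cast.2 hN)) (fun a _ => hlip a)
    (digitSums_subset_biUnion_image hN0 A) (isBounded_digitSums hN A)

lemma isAPSet_digitSums {k : ℕ} (hk : 0 < k) (hN : 1 < N)
    (hA : ∀ d : ℕ, d < N → ContainsAP k (d : ℤ) (A : Set ℤ)) : IsAPSet k (digitSums A N) := by
  intro t ht
  obtain ⟨e, -, rfl⟩ := Real.ofDigits_SurjOn hN ht
  choose b hb using fun i => hA (e i) (e i).2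
  have hstart : ∀ i, b i ∈ A := fun i => by simpa using hb i 0 hk
  refine ⟨∑' i, (b i : ℝ) / (N : ℝ) ^ (i + 1), fun l hl =>
    ⟨fun i => b i + l * (e i : ℕ), fun i => hb i l hl, ?_⟩⟩
  convert! (summable_digits hN hstart).hasSum.add
    (Real.summable_ofDigitsTerm (digits := e).hasSum.mul_left (l : ℝ)) using 2 with i
  rw [Real.ofDigitsTerm]
  push_cast
  ring

end DigitSums

/-! ### The arithmetic Kakeya conjecture in terms of `fM` -/

section ArithmeticKakeya

lemma apNumber_le_card {k N : ℕ} (A : Finset ℤ)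
    (h : ∀ d : ℕ, 1 ≤ d → d ≤ N → ContainsAP k (d : ℤ) (A : Set ℤ)) : apNumber k N ≤ A.card :=
  Nat.sInf_le ⟨A, rfl, h⟩

lemma exists_card_eq_apNumber (k N : ℕ) : ∃ A : Finset ℤ, A.card = apNumber k N ∧
    ∀ d : ℕ, 1 ≤ d → d ≤ N → ContainsAP k (d : ℤ) (A : Set ℤ) := by
  refine Nat.sInf_mem (s := {c : ℕ | ∃ A : Finset ℤ, A.card = c ∧
    ∀ d : ℕ, 1 ≤ d → d ≤ N → ContainsAP k (d : ℤ) (A : Set ℤ)})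
    ⟨_, Finset.Icc 0 ((k * N : ℕ) : ℤ), rfl, fun d _ hd => ⟨0, fun i hi => ?_⟩⟩
  simp only [zero_add, Finset.coe_Icc, Set.mem_Icc]
  exact ⟨by positivity, by exact_mod_cast Nat.mul_le_mul hi.le hd⟩

lemma apNumber_pos {k N : ℕ} (hk : 0 < k) (hN : 0 < N) : 0 < apNumber k N := by
  obtain ⟨A, hA, hAP⟩ := exists_card_eq_apNumber k N
  obtain ⟨a, ha⟩ := hAP 1 le_rfl hN
  exact hA ▸ Finset.card_pos.2 ⟨_, ha 0 hk⟩

lemma fM_le_log_apNumber {k N : ℕ} (hk : 0 < k) (hN : 1 < N) :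
    fM k ≤ ((Real.log (apNumber k N) / Real.log N : ℝ) : EReal) := by
  obtain ⟨A, hA, hAP⟩ := exists_card_eq_apNumber k N
  have hAP' (d : ℕ) (hd : d < N) : ContainsAP k (d : ℤ) (A : Set ℤ) := by
    rcases d.eq_zero_or_pos with rfl | hd0
    · obtain ⟨a, ha⟩ := hAP 1 le_rfl hN.le
      exact ⟨a, fun i _ => by simpa using ha 0 hk⟩
    · exact hAP d hd0 hd.le
  rw [← hA, Real.log_div_log]
  refine (iInf₂_le _ (isAPSet_digitSums hk hN hAP')).trans
    ((boxBound_digitSums hN A).dimM_le ?_)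
  exact div_nonneg (Real.log_natCast_nonneg _) (Real.log_natCast_nonneg _)

lemma ContainsAP.floor_image {k d N : ℕ} (hN : N ≠ 0) {A : Set ℝ}
    (h : ContainsAP k ((d : ℝ) / N) A) :
    ContainsAP k (d : ℤ) ((fun x : ℝ => ⌊N * x⌋) '' A) := by
  obtain ⟨a, ha⟩ := h
  refine ⟨⌊N * a⌋, fun i hi => ⟨_, ha i hi, ?_⟩⟩
  have hsplit : (N : ℝ) * (a + i * (d / N)) = N * a + ((i * d : ℤ) : ℝ) := by
    push_cast
    field_simp
  simp only [hsplit, Int.floor_add_intCast]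

lemma floor_mem_Icc_of_abs_sub_le_one {x y : ℝ} (h : |x - y| ≤ 1) :
    ⌊x⌋ ∈ Finset.Icc (⌊y⌋ - 1) (⌊y⌋ + 1) := by
  rw [abs_le] at h
  have hle := Int.floor_mono (show x ≤ y + 1 by linarith)
  have hge := Int.floor_mono (show y ≤ x + 1 by linarith)
  rw [Int.floor_add_one] at hle hge
  exact Finset.mem_Icc.2 ⟨by omega, hle⟩

lemma BoxBound.exists_floor_image_subset {A : Set ℝ} {s : ℝ} (h : BoxBound A s) :
    ∃ C : ℝ, 0 < C ∧ ∀ N : ℕ, 1 < N → ∃ G : Finset ℤ, (G.card : ℝ) ≤ C * (N : ℝ) ^ s ∧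
      (fun x : ℝ => ⌊N * x⌋) '' A ⊆ G := by
  classical
  obtain ⟨C, hC, hcover⟩ := h
  refine ⟨3 * C, by positivity, fun N hN => ?_⟩
  have hN1 : (1 : ℝ) < N := Nat.one_lt_cast.2 hN
  have hN0 : (0 : ℝ) < N := by linarith
  obtain ⟨F, hF, hcov⟩ := hcover (N : ℝ)⁻¹ (by positivity) (inv_lt_one_of_one_lt₀ hN1)
  rw [Real.inv_rpow hN0.le, Real.rpow_neg hN0.le, inv_inv] at hF
  let G := F.biUnion fun y => Finset.Icc (⌊N * y⌋ - 1) (⌊N * y⌋ + 1)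
  have hG : G.card ≤ F.card * 3 := Finset.card_biUnion_le_card_mul F _ 3 fun y _ => by
    rw [Int.card_Icc]
    omega
  refine ⟨G, ?_, ?_⟩
  · calc (G.card : ℝ) ≤ F.card * 3 := by exact_mod_cast hG
      _ ≤ 3 * C * (N : ℝ) ^ s := by linarith
  · rintro _ ⟨x, hx, rfl⟩
    obtain ⟨y, hy, hxy⟩ := hcov x hx
    refine Finset.mem_biUnion.2 ⟨y, hy, floor_mem_Icc_of_abs_sub_le_one ?_⟩
    rw [← mul_sub, abs_mul, abs_of_pos hN0, ← le_inv_mul_iff₀ hN0, mul_one]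
    exact hxy

lemma exists_apNumber_le_of_fM_lt {k : ℕ} {s : ℝ} (h : fM k < s) :
    ∃ C : ℝ, 0 < C ∧ ∀ N : ℕ, 1 < N → (apNumber k N : ℝ) ≤ C * (N : ℝ) ^ s := by
  obtain ⟨A, hlt⟩ := iInf_lt_iff.1 h
  obtain ⟨hA, hAs⟩ := iInf_lt_iff.1 hlt
  obtain ⟨C, hC, hfloor⟩ := (boxBound_of_dimM_lt hAs).exists_floor_image_subset
  refine ⟨C, hC, fun N hN => ?_⟩
  obtain ⟨G, hG, hsub⟩ := hfloor N hN
  have hle : apNumber k N ≤ G.card := apNumber_le_card G fun d _ hd =>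
    (ContainsAP.floor_image (by omega) (hA (d / N) ⟨by positivity,
      div_le_one_of_le₀ (by exact_mod_cast hd) (by positivity)⟩)).mono hsub
  exact (Nat.cast_le.2 hle).trans hG

lemma fM_mono : Monotone fM := fun _ _ h =>
  iInf_mono fun _ => iInf_mono' fun hA =>
    ⟨fun t ht => (hA t ht).imp fun _ ha i hi => ha i (hi.trans_le h), le_rfl⟩

lemma coe_toReal_fM (k : ℕ) : (((fM k).toReal : ℝ) : EReal) = fM k :=
  EReal.coe_toReal
    (ne_top_of_le_ne_top (EReal.coe_ne_top _)
      ((fM_mono k.le_succ).trans (fM_le_log_apNumber k.succ_pos one_lt_two)))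
    (ne_bot_of_le_ne_bot EReal.zero_ne_bot (fM_nonneg k))

lemma tendsto_log_apNumber {k : ℕ} (hk : 0 < k) :
    Tendsto (fun N : ℕ => Real.log (apNumber k N) / Real.log N) atTop (𝓝 (fM k).toReal) := by
  refine tendsto_order.2 ⟨fun c hc => ?_, fun c hc => ?_⟩
  · filter_upwards [eventually_gt_atTop 1] with N hN
    exact hc.trans_le (EReal.coe_le_coe_iff.1
      ((coe_toReal_fM k).trans_le (fM_le_log_apNumber hk hN)))
  · obtain ⟨z, hfz, hzc⟩ := exists_between hc
    obtain ⟨C, hC, hle⟩ := exists_apNumber_le_of_fM_lt (k := k) (s := z)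
      (by rw [← coe_toReal_fM k]; exact_mod_cast hfz)
    have hlim : Tendsto (fun N : ℕ => Real.log C / Real.log N + z) atTop (𝓝 z) := by
      simpa using ((Real.tendsto_log_atTop.comp
        tendsto_natCast_atTop_atTop).const_div_atTop (Real.log C)).add_const z
    filter_upwards [eventually_gt_atTop 1, hlim.eventually (gt_mem_nhds hzc)] with N hN hlt
    refine lt_of_le_of_lt ?_ hlt
    have hN0 : (0 : ℝ) < N := by positivity
    have hlogN : 0 < Real.log N := Real.log_pos (Nat.one_lt_cast.2 hN)
    have hlog := Real.log_le_log (by exact_mod_cast apNumber_pos hk (by omega)) (hle N hN)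
    rw [Real.log_mul hC.ne' (by positivity), Real.log_rpow hN0] at hlog
    rw [div_add' _ _ _ hlogN.ne']
    gcongr

lemma arithmeticKakeya_iff :
    ArithmeticKakeya ↔ Tendsto (fun k => (fM k).toReal) atTop (𝓝 1) := by
  refine ⟨fun ⟨L, hL, hL1⟩ => hL1.congr' ?_, fun h => ⟨_, fun k hk => tendsto_log_apNumber hk, h⟩⟩
  filter_upwards [eventually_ge_atTop 1] with k hk
  exact tendsto_nhds_unique (hL k hk) (tendsto_log_apNumber hk)

end ArithmeticKakeya

/-! ### Nets of the sphere with equally spaced heights -/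

section SphereNet

lemma exists_norm_eq_one_smul_eq {E : Type*} [NormedAddCommGroup E] [NormedSpace ℝ E]
    [Nontrivial E] (w : E) : ∃ v : E, ‖v‖ = 1 ∧ ‖w‖ • v = w := by
  rcases eq_or_ne w 0 with rfl | hw
  · obtain ⟨v, hv⟩ := exists_norm_eq E zero_le_one
    exact ⟨v, hv, by simp⟩
  · have hw' : ‖w‖ ≠ 0 := norm_ne_zero_iff.2 hw
    exact ⟨‖w‖⁻¹ • w, by rw [norm_smul, norm_inv, norm_norm, inv_mul_cancel₀ hw'],
      smul_inv_smul₀ hw' w⟩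

lemma exists_abs_sub_grid_le {R : ℕ} (hR : 0 < R) {a : ℝ} (ha : a ∈ Set.Icc (-1 : ℝ) 1) :
    ∃ l : ℕ, l < 2 * R + 1 ∧ |a - (-1 + l * (1 / (R : ℝ)))| ≤ 1 / R := by
  have hR' : (0 : ℝ) < R := Nat.cast_pos.2 hR
  have hnonneg : 0 ≤ (a + 1) * R := mul_nonneg (by linarith [ha.1]) hR'.le
  have hfloor_le := Nat.floor_le hnonneg
  refine ⟨⌊(a + 1) * R⌋₊, ?_, ?_⟩
  · have hle : (⌊(a + 1) * R⌋₊ : ℝ) ≤ ((2 * R : ℕ) : ℝ) := by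
      push_cast
      nlinarith [ha.2]
    exact Nat.lt_succ_iff.2 (by exact_mod_cast hle)
  · have hsub : a - (-1 + ⌊(a + 1) * R⌋₊ * (1 / (R : ℝ))) =
        ((a + 1) * R - ⌊(a + 1) * R⌋₊) / R := by
      field_simp
      ring
    rw [hsub, abs_of_nonneg (div_nonneg (sub_nonneg.2 hfloor_le) hR'.le)]
    gcongr
    linarith [Nat.lt_floor_add_one ((a + 1) * (R : ℝ))]

lemma grid_mem_Icc {R l : ℕ} (hl : l < 2 * R + 1) :
    -1 + (l : ℝ) * (1 / (R : ℝ)) ∈ Set.Icc (-1 : ℝ) 1 := by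
  have hle : (l : ℝ) * (1 / (R : ℝ)) ≤ 2 := by
    rw [mul_one_div]
    exact div_le_of_le_mul₀ (by positivity) zero_le_two
      (by exact_mod_cast Nat.lt_succ_iff.1 hl)
  exact ⟨le_add_of_nonneg_right (by positivity), by linarith⟩

lemma dist_sqrt_one_sub_sq_le_uniformly {ε : ℝ} (hε : 0 < ε) :
    ∃ η > 0, ∀ a ∈ Set.Icc (-1 : ℝ) 1, ∀ b ∈ Set.Icc (-1 : ℝ) 1, |a - b| < η →
      |√(1 - a ^ 2) - √(1 - b ^ 2)| < ε :=
  Metric.uniformContinuousOn_iff.1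
    (isCompact_Icc.uniformContinuousOn_of_continuous
      (f := fun a : ℝ => √(1 - a ^ 2)) (by fun_prop)) ε hε

variable {E : Type*} [NormedAddCommGroup E] [InnerProductSpace ℝ E] {e : E}

/-- The point of the unit sphere at height `c` above the equator orthogonal to `e`, on the meridian
through the equatorial point `v`. -/
noncomputable def spherePoint (e : E) (c : ℝ) (v : (ℝ ∙ e)ᗮ) : E := c • e + √(1 - c ^ 2) • (v : E)

lemma inner_spherePoint (he : ‖e‖ = 1) (c : ℝ) (v : (ℝ ∙ e)ᗮ) :
    inner ℝ e (spherePoint e c v) = c := by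
  have hperp : inner ℝ e (v : E) = 0 := Submodule.mem_orthogonal_singleton_iff_inner_right.1 v.2
  rw [spherePoint, inner_add_right, inner_smul_right, inner_smul_right, hperp,
    real_inner_self_eq_norm_sq, he]
  ring

lemma norm_spherePoint (he : ‖e‖ = 1) {c : ℝ} (hc : c ∈ Set.Icc (-1 : ℝ) 1) {v : (ℝ ∙ e)ᗮ}
    (hv : ‖v‖ = 1) : ‖spherePoint e c v‖ = 1 := by
  have hperp : inner ℝ e (v : E) = 0 := Submodule.mem_orthogonal_singleton_iff_inner_right.1 v.2
  have hv' : ‖(v : E)‖ = 1 := hv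
  have hsq : ‖spherePoint e c v‖ ^ 2 = 1 := by
    rw [spherePoint, norm_add_sq_real, inner_smul_left, inner_smul_right, hperp, norm_smul,
      norm_smul, he, hv', mul_one, mul_one, Real.norm_eq_abs, Real.norm_eq_abs,
      sq_abs, sq_abs, Real.sq_sqrt (by nlinarith [hc.1, hc.2])]
    ring
  exact (pow_eq_one_iff_of_nonneg (norm_nonneg _) two_ne_zero).1 hsq

lemma exists_spherePoint_eq [Nontrivial (ℝ ∙ e)ᗮ] (he : ‖e‖ = 1) {y : E} (hy : ‖y‖ = 1) :
    ∃ v : (ℝ ∙ e)ᗮ, ‖v‖ = 1 ∧ spherePoint e (inner ℝ e y) v = y := by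
  have hperp : y - inner ℝ e y • e ∈ (ℝ ∙ e)ᗮ := by
    rw [Submodule.mem_orthogonal_singleton_iff_inner_right, inner_sub_right, inner_smul_right,
      real_inner_self_eq_norm_sq, he]
    ring
  obtain ⟨v, hv, hvw⟩ := exists_norm_eq_one_smul_eq (⟨_, hperp⟩ : (ℝ ∙ e)ᗮ)
  have hsq : ‖y - inner ℝ e y • e‖ ^ 2 = 1 - inner ℝ e y ^ 2 := by
    rw [norm_sub_sq_real, hy, inner_smul_right, real_inner_comm, norm_smul, he, mul_one,
      Real.norm_eq_abs, sq_abs]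
    ring
  refine ⟨v, hv, ?_⟩
  rw [spherePoint, ← hsq, Real.sqrt_sq (norm_nonneg _)]
  exact add_eq_of_eq_sub' (congrArg Subtype.val hvw)

lemma dist_spherePoint_le (he : ‖e‖ = 1) (a b : ℝ) {v : (ℝ ∙ e)ᗮ} (hv : ‖v‖ = 1) (w : (ℝ ∙ e)ᗮ) :
    dist (spherePoint e a v) (spherePoint e b w) ≤
      |a - b| + |√(1 - a ^ 2) - √(1 - b ^ 2)| + dist v w := by
  have hv' : ‖(v : E)‖ = 1 := hv
  have hb : √(1 - b ^ 2) ≤ 1 := Real.sqrt_le_one.2 (by linarith [sq_nonneg b])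
  have hsub : spherePoint e a v - spherePoint e b w = (a - b) • e +
      (√(1 - a ^ 2) - √(1 - b ^ 2)) • (v : E) + √(1 - b ^ 2) • ((v : E) - w) := by
    simp only [spherePoint]
    module
  rw [dist_eq_norm, hsub]
  refine (norm_add₃_le ..).trans (add_le_add_three ?_ ?_ ?_)
  · rw [norm_smul, he, mul_one, Real.norm_eq_abs]
  · rw [norm_smul, hv', mul_one, Real.norm_eq_abs]
  · rw [norm_smul, Real.norm_of_nonneg (Real.sqrt_nonneg _), Subtype.dist_eq, dist_eq_norm]
    exact mul_le_of_le_one_left (norm_nonneg _) hb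

lemma eventually_exists_sphere_net [FiniteDimensional ℝ E] [Nontrivial (ℝ ∙ e)ᗮ] (he : ‖e‖ = 1)
    {δ : ℝ} (hδ : 0 < δ) : ∀ᶠ R : ℕ in atTop, ∃ Q : Finset E, (∀ v ∈ Q, ‖v‖ = 1) ∧
      (∀ y, ‖y‖ = 1 → ∃ v ∈ Q, dist y v ≤ δ) ∧
      (fun v => inner ℝ e v) '' (Q : Set E) =
        {t | ∃ l : ℕ, l < 2 * R + 1 ∧ t = -1 + l * (1 / (R : ℝ))} := by
  classical
  obtain ⟨η, hη, hsqrt⟩ := dist_sqrt_one_sub_sq_le_uniformly (show 0 < δ / 3 by positivity)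
  obtain ⟨Z, hZ, hZfin, hZcov⟩ :=
    (isCompact_sphere (0 : (ℝ ∙ e)ᗮ) 1).finite_cover_balls (show 0 < δ / 3 by positivity)
  have hZ1 (v : (ℝ ∙ e)ᗮ) (hv : v ∈ hZfin.toFinset) : ‖v‖ = 1 := by
    simpa using hZ (hZfin.mem_toFinset.1 hv)
  have hZnet (v : (ℝ ∙ e)ᗮ) (hv : ‖v‖ = 1) : ∃ w ∈ hZfin.toFinset, dist v w < δ / 3 := by
    simpa using hZcov (show v ∈ Metric.sphere 0 1 by simpa using hv)
  filter_upwards [eventually_gt_atTop 0, tendsto_one_div_atTop_nhds_zero_nat.eventually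
    (gt_mem_nhds (show 0 < min η (δ / 3) by positivity))] with R hR hRη
  let grid (l : ℕ) : ℝ := -1 + l * (1 / (R : ℝ))
  refine ⟨(Finset.range (2 * R + 1) ×ˢ hZfin.toFinset).image fun q => spherePoint e (grid q.1) q.2,
    ?_, fun y hy => ?_, ?_⟩
  · simp only [Finset.forall_mem_image, Finset.mem_product, Finset.mem_range, Prod.forall, and_imp]
    exact fun l v hl hv => norm_spherePoint he (grid_mem_Icc hl) (hZ1 v hv)
  · obtain ⟨v, hv, hvy⟩ := exists_spherePoint_eq he hy
    have hheight : inner ℝ e y ∈ Set.Icc (-1 : ℝ) 1 :=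
      abs_le.1 ((abs_real_inner_le_norm e y).trans (by rw [he, hy, mul_one]))
    obtain ⟨l, hl, hgrid⟩ := exists_abs_sub_grid_le hR hheight
    obtain ⟨w, hw, hvw⟩ := hZnet v hv
    refine ⟨_, Finset.mem_image.2 ⟨(l, w), Finset.mk_mem_product (Finset.mem_range.2 hl) hw, rfl⟩,
      ?_⟩
    have hlt := hgrid.trans_lt hRη
    have hdist := dist_spherePoint_le he (inner ℝ e y) (grid l) hv w
    have hroot := hsqrt _ hheight _ (grid_mem_Icc hl) (hlt.trans_le (min_le_left _ _))
    rw [hvy] at hdist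
    linarith [hlt.trans_le (min_le_right _ _)]
  · obtain ⟨v, hv⟩ := exists_norm_eq (ℝ ∙ e)ᗮ zero_le_one
    obtain ⟨w, hw, -⟩ := hZnet v hv
    ext t
    simp only [Finset.coe_image, Set.image_image, inner_spherePoint he, Set.mem_image,
      Finset.mem_coe, Finset.mem_product, Finset.mem_range, Prod.exists, Set.mem_ofPred_eq]
    exact ⟨fun ⟨l, _, ⟨hl, _⟩, h⟩ => ⟨l, hl, h.symm⟩, fun ⟨l, hl, h⟩ => ⟨l, w, ⟨hl, hw⟩, h.symm⟩⟩

lemma norm_le_mul_inner_of_sphere_net {ρ : ℝ} (hρ : 0 < ρ) {Q : Set E} (hQ : Q.Nonempty)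
    (hQ1 : ∀ v ∈ Q, ‖v‖ = 1) (hnet : ∀ y, ‖y‖ = 1 → ∃ v ∈ Q, dist y v ≤ 1 - ρ⁻¹) (y : E) :
    ∃ v ∈ Q, ‖y‖ ≤ ρ * inner ℝ v y := by
  rcases eq_or_ne y 0 with rfl | hy
  · exact ⟨hQ.some, hQ.some_mem, by simp⟩
  have hy0 : 0 < ‖y‖ := norm_pos_iff.2 hy
  obtain ⟨v, hv, hdist⟩ := hnet (‖y‖⁻¹ • y)
    (by rw [norm_smul, norm_inv, norm_norm, inv_mul_cancel₀ hy0.ne'])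
  refine ⟨v, hv, ?_⟩
  have hinner : 1 - ‖y‖⁻¹ * inner ℝ v y ≤ dist (‖y‖⁻¹ • y) v := by
    calc 1 - ‖y‖⁻¹ * inner ℝ v y = inner ℝ v (v - ‖y‖⁻¹ • y) := by
          rw [inner_sub_right, inner_smul_right, real_inner_self_eq_norm_sq, hQ1 v hv, one_pow]
      _ ≤ ‖v‖ * ‖v - ‖y‖⁻¹ • y‖ := real_inner_le_norm _ _
      _ = dist (‖y‖⁻¹ • y) v := by rw [hQ1 v hv, one_mul, dist_comm, dist_eq_norm]
  have hle : ρ⁻¹ ≤ ‖y‖⁻¹ * inner ℝ v y := by linarith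
  rwa [inv_mul_eq_div, le_div_iff₀ hy0, inv_mul_le_iff₀ hρ] at hle

end SphereNet

/-! ### Polytopes circumscribed about the unit sphere -/

section Circumscribed

variable {n s : ℕ} {u : Fin s → EuclideanSpace ℝ (Fin n)} {ρ : ℝ}

lemma norm_le_of_mem_circumscribed (hρ : 0 ≤ ρ) (hnet : ∀ y, ∃ i, ‖y‖ ≤ ρ * inner ℝ (u i) y)
    {y : EuclideanSpace ℝ (Fin n)} (hy : y ∈ body u 1) : ‖y‖ ≤ ρ := by
  obtain ⟨i, hi⟩ := hnet y
  exact hi.trans (mul_le_of_le_one_right hρ (hy i))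

lemma exists_mem_discHeights_circumscribed_face (hu : ∀ i, ‖u i‖ = 1)
    (hinj : Function.Injective u) (i : Fin s) :
    ∃ δ > 0, 1 ∈ discHeights (u i) δ (body u 1 ∩ hyperplane (u i) 1) := by
  have hopen : IsOpen (⋂ k : {k // k ≠ i}, {y | inner ℝ (u k) y < 1}) :=
    isOpen_iInter_of_finite fun k => isOpen_lt (by fun_prop) (by fun_prop)
  have hmem : u i ∈ ⋂ k : {k // k ≠ i}, {y | inner ℝ (u k) y < 1} :=
    Set.mem_iInter.2 fun k =>
      (inner_lt_one_iff_real_of_norm_eq_one (hu k) (hu i)).2 fun h => k.2 (hinj h)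
  have hself : inner ℝ (u i) (u i) = (1 : ℝ) := by rw [real_inner_self_eq_norm_sq, hu, one_pow]
  obtain ⟨δ, hδ, hball⟩ := Metric.isOpen_iff.1 hopen _ hmem
  refine ⟨δ, hδ, u i, hself, fun w hw hwδ => ?_⟩
  have hplane : inner ℝ (u i) (u i + w) = 1 := by
    rw [inner_add_right, hself, Submodule.mem_orthogonal_singleton_iff_inner_right.1 hw, add_zero]
  refine ⟨fun k => ?_, hplane⟩
  rcases eq_or_ne k i with rfl | hk
  · exact hplane.le
  · exact (Set.mem_iInter.1 (hball (by simpa using hwδ)) ⟨k, hk⟩).le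

lemma isPolytopeWith_circumscribed (hu : ∀ i, ‖u i‖ = 1) (hinj : Function.Injective u)
    (hρ : 0 ≤ ρ) (hnet : ∀ y, ∃ i, ‖y‖ ≤ ρ * inner ℝ (u i) y) :
    IsPolytopeWith u 1 (frontier (body u 1)) where
  norm_normal := hu
  bounded := isBounded_iff_forall_norm_le.2 ⟨ρ, fun _ => norm_le_of_mem_circumscribed hρ hnet⟩
  interior_nonempty := ⟨0, mem_interior_body fun i => by simp⟩
  facet i := by
    obtain ⟨δ, hδ, hdisc⟩ := exists_mem_discHeights_circumscribed_face hu hinj i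
    have hspan : vectorSpan ℝ (body u 1 ∩ hyperplane (u i) 1) = (ℝ ∙ u i)ᗮ :=
      (vectorSpan_le_orthogonal fun y hy => hy.2).antisymm
        (orthogonal_le_vectorSpan_of_mem_discHeights hδ hdisc)
    have hui : u i ≠ 0 := norm_ne_zero_iff.1 (by rw [hu i]; exact one_ne_zero)
    rw [Pi.one_apply, hspan, finrank_orthogonal_span_singleton_add_one hui,
      finrank_euclideanSpace_fin]
  eq_frontier := rfl

lemma edist_smul_self_le {E : Type*} [NormedAddCommGroup E] [NormedSpace ℝ E] {x : E}
    (hx : ‖x‖ = 1) {t : ℝ} (ht : 1 ≤ t) (htρ : t ≤ ρ) :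
    edist (t • x) x ≤ ENNReal.ofReal (ρ - 1) := by
  have hsub : t • x - x = (t - 1) • x := by rw [sub_smul, one_smul]
  rw [edist_dist, dist_eq_norm, hsub, norm_smul, hx, mul_one, Real.norm_of_nonneg (by linarith)]
  gcongr

lemma exists_mem_sphere_of_mem_frontier_circumscribed (hu : ∀ i, ‖u i‖ = 1) (hρ : 0 ≤ ρ)
    (hnet : ∀ y, ∃ i, ‖y‖ ≤ ρ * inner ℝ (u i) y) {y : EuclideanSpace ℝ (Fin n)}
    (hy : y ∈ frontier (body u 1)) :
    ∃ x ∈ Metric.sphere 0 1, edist y x ≤ ENNReal.ofReal (ρ - 1) := by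
  obtain ⟨hyb, i, hi⟩ := mem_body_and_exists_eq_of_mem_frontier hy
  have hy1 : 1 ≤ ‖y‖ := by simpa [hu i, hi] using real_inner_le_norm (u i) y
  have hy0 : ‖y‖ ≠ 0 := by linarith
  have hx : ‖‖y‖⁻¹ • y‖ = 1 := by rw [norm_smul, norm_inv, norm_norm, inv_mul_cancel₀ hy0]
  refine ⟨‖y‖⁻¹ • y, mem_sphere_zero_iff_norm.2 hx, ?_⟩
  simpa [smul_inv_smul₀ hy0] using
    edist_smul_self_le hx hy1 (norm_le_of_mem_circumscribed hρ hnet hyb)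

lemma exists_mem_frontier_circumscribed_of_mem_sphere (hu : ∀ i, ‖u i‖ = 1) (hρ : 0 ≤ ρ)
    (hnet : ∀ y, ∃ i, ‖y‖ ≤ ρ * inner ℝ (u i) y) {x : EuclideanSpace ℝ (Fin n)}
    (hx : x ∈ Metric.sphere 0 1) :
    ∃ y ∈ frontier (body u 1), edist x y ≤ ENNReal.ofReal (ρ - 1) := by
  rw [mem_sphere_zero_iff_norm] at hx
  obtain ⟨i₀, hi₀⟩ := hnet x
  obtain ⟨i, -, hmax⟩ := Finset.exists_max_image Finset.univ (fun i => inner ℝ (u i) x)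
    ⟨i₀, Finset.mem_univ _⟩
  have hle : 1 ≤ ρ * inner ℝ (u i) x := by
    rw [← hx]
    exact hi₀.trans (mul_le_mul_of_nonneg_left (hmax i₀ (Finset.mem_univ _)) hρ)
  have hpos : 0 < inner ℝ (u i) x := pos_of_mul_pos_right (one_pos.trans_le hle) hρ
  have hone : inner ℝ (u i) x ≤ 1 := by simpa [hu i, hx] using real_inner_le_norm (u i) x
  have hbody : (inner ℝ (u i) x)⁻¹ • x ∈ body u 1 := fun k => by
    rw [inner_smul_right, Pi.one_apply, inv_mul_le_iff₀ hpos, mul_one]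
    exact hmax k (Finset.mem_univ _)
  refine ⟨_, mem_frontier_body_of_eq hbody (hu i) ?_, ?_⟩
  · rw [inner_smul_right, inv_mul_cancel₀ hpos.ne', Pi.one_apply]
  · rw [edist_comm]
    exact edist_smul_self_le hx ((one_le_inv₀ hpos).2 hone)
      ((inv_le_iff_one_le_mul₀ hpos).2 hle)

lemma hausdorffEDist_circumscribed_le (hu : ∀ i, ‖u i‖ = 1) (hρ : 0 ≤ ρ)
    (hnet : ∀ y, ∃ i, ‖y‖ ≤ ρ * inner ℝ (u i) y) :
    Metric.hausdorffEDist (frontier (body u 1)) (Metric.sphere 0 1) ≤ ENNReal.ofReal (ρ - 1) :=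
  Metric.hausdorffEDist_le_of_mem_edist
    (fun _ => exists_mem_sphere_of_mem_frontier_circumscribed hu hρ hnet)
    (fun _ => exists_mem_frontier_circumscribed_of_mem_sphere hu hρ hnet)

end Circumscribed

lemma exists_isHarmonic_near_sphere {n : ℕ} [NeZero n] (hn : 1 < n) {ε : ℝ} (hε : 0 < ε) (k : ℕ) :
    ∃ (m s : ℕ) (u : Fin s → EuclideanSpace ℝ (Fin n)) (d j : Fin s → ℝ)
      (P : Set (EuclideanSpace ℝ (Fin n))), k ≤ m ∧ IsPolytopeWith u d P ∧ IsHarmonic u d j m ∧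
      Metric.hausdorffEDist P (Metric.sphere 0 1) ≤ ENNReal.ofReal ε := by
  let e : EuclideanSpace ℝ (Fin n) := EuclideanSpace.single 0 1
  have he : ‖e‖ = 1 := by simp [e]
  have hcoord (v : EuclideanSpace ℝ (Fin n)) : inner ℝ e v = v 0 := by
    simp [e, EuclideanSpace.inner_single_left]
  have : Nontrivial (ℝ ∙ e)ᗮ := nontrivial_orthogonal_span_singleton (by simp [e]) (by simpa)
  have hδ : 0 < 1 - (1 + ε)⁻¹ := sub_pos.2 (inv_lt_one_of_one_lt₀ (by linarith))
  obtain ⟨R, ⟨Q, hQ1, hQnet, hheights⟩, hkR⟩ :=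
    ((eventually_exists_sphere_net he hδ).and (eventually_gt_atTop k)).exists
  have hQ : (Q : Set (EuclideanSpace ℝ (Fin n))).Nonempty := (hQnet e he).imp fun v hv => hv.1
  let u (i : Fin Q.card) : EuclideanSpace ℝ (Fin n) := Q.equivFin.symm i
  have hinj : Function.Injective u := Subtype.val_injective.comp Q.equivFin.symm.injective
  have hrange : Set.range u = Q :=
    (Q.equivFin.symm.surjective.range_comp Subtype.val).trans Subtype.range_coe
  have hu1 (i : Fin Q.card) : ‖u i‖ = 1 := hQ1 _ (Q.equivFin.symm i).2
  have hnet (y : EuclideanSpace ℝ (Fin n)) : ∃ i, ‖y‖ ≤ (1 + ε) * inner ℝ (u i) y := by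
    rw [← Set.exists_range_iff (p := fun v => ‖y‖ ≤ (1 + ε) * inner ℝ v y), hrange]
    exact norm_le_mul_inner_of_sphere_net (by positivity) hQ hQ1 hQnet y
  have hρ : 0 ≤ 1 + ε := by positivity
  have hstep : 1 / (R : ℝ) ≠ 0 := one_div_ne_zero (Nat.cast_ne_zero.2 (by omega))
  refine ⟨2 * R + 1, Q.card, u, 1, fun i => u i 0, frontier (body u 1), by omega,
    isPolytopeWith_circumscribed hu1 hinj hρ hnet,
    ⟨fun _ => one_ne_zero, ⟨-1, 1 / R, hstep, ?_⟩, fun i => mul_one _⟩, ?_⟩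
  · rw [← hheights, ← hrange, ← Set.range_comp]
    simp only [Function.comp_def, hcoord]
  · simpa using hausdorffEDist_circumscribed_le hu1 hρ hnet

/-! ### Homothets centred in the unit cube -/

lemma ContainsHomothets.mono {n : ℕ} {P S T B : Set (EuclideanSpace ℝ (Fin n))}
    (h : ContainsHomothets P T B) (hST : S ⊆ T) : ContainsHomothets P S B :=
  fun x hx => h x (hST hx)

lemma unitSegment_subset_unitCube (n : ℕ) [NeZero n] : unitSegment n ⊆ unitCube n := by
  intro x hx i
  rcases eq_or_ne i 0 with rfl | hi
  · exact hx.1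
  · rw [hx.2 i hi]
    exact Set.left_mem_Icc.2 zero_le_one

lemma hM_le_gM {n : ℕ} [NeZero n] (P : Set (EuclideanSpace ℝ (Fin n))) : hM P ≤ gM P :=
  iInf_mono fun _ => iInf_mono' fun hB => ⟨hB.mono (unitSegment_subset_unitCube n), le_rfl⟩

lemma hP_le_gP {n : ℕ} [NeZero n] (P : Set (EuclideanSpace ℝ (Fin n))) : hP P ≤ gP P :=
  iInf_mono fun _ => iInf_mono' fun hB => ⟨hB.mono (unitSegment_subset_unitCube n), le_rfl⟩

lemma isBounded_unitCube (n : ℕ) : Bornology.IsBounded (unitCube n) := by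
  refine isBounded_iff_forall_norm_le.2 ⟨√n, fun x hx => ?_⟩
  rw [EuclideanSpace.norm_eq]
  gcongr
  calc ∑ i, ‖x i‖ ^ 2 ≤ ∑ _i : Fin n, (1 : ℝ) := Finset.sum_le_sum fun i _ =>
        pow_le_one₀ (norm_nonneg _) ((Real.norm_of_nonneg (hx i).1).trans_le (hx i).2)
    _ = n := by simp

lemma leastDimM_le_of_isBounded {n : ℕ} {P S : Set (EuclideanSpace ℝ (Fin n))}
    (hP : Bornology.IsBounded P) (hS : Bornology.IsBounded S) : leastDimM P S ≤ n := by
  obtain ⟨R, hR⟩ := (hS.add hP).exists_norm_le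
  have hball : BoxBound (Metric.closedBall (0 : EuclideanSpace ℝ (Fin n)) R) n := by
    simpa using boxBound_closedBall (V := EuclideanSpace ℝ (Fin n)) R
  refine (iInf₂_le _ fun x hx => ⟨1, one_ne_zero, fun y hy => ?_⟩).trans
    (hball.dimM_le n.cast_nonneg)
  rw [mem_closedBall_zero_iff, one_smul]
  exact hR _ (Set.add_mem_add hx hy)

lemma IsPolytopeWith.gM_le {n s : ℕ} {u : Fin s → EuclideanSpace ℝ (Fin n)} {d : Fin s → ℝ}
    {P : Set (EuclideanSpace ℝ (Fin n))} (h : IsPolytopeWith u d P) : gM P ≤ n :=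
  leastDimM_le_of_isBounded
    (h.eq_frontier ▸ h.bounded.subset isClosed_body.frontier_subset) (isBounded_unitCube n)

/-! ### Polytopes with more and more labels -/

lemma exists_isHarmonic_tendsto_sphere {n : ℕ} [NeZero n] (hn : 1 < n) :
    ∃ (m s : ℕ → ℕ) (u : ∀ k, Fin (s k) → EuclideanSpace ℝ (Fin n)) (d j : ∀ k, Fin (s k) → ℝ)
      (P : ℕ → Set (EuclideanSpace ℝ (Fin n))), Tendsto m atTop atTop ∧
      (∀ k, IsPolytopeWith (u k) (d k) (P k)) ∧ (∀ k, IsHarmonic (u k) (d k) (j k) (m k)) ∧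
      Tendsto (fun k => Metric.hausdorffEDist (P k) (Metric.sphere 0 1)) atTop (𝓝 0) := by
  choose m s u d j P hm hPoly hH hdist using fun k : ℕ =>
    exists_isHarmonic_near_sphere hn (Nat.one_div_pos_of_nat (α := ℝ) (n := k)) k
  refine ⟨m, s, u, d, j, P, tendsto_atTop_mono hm tendsto_id, hPoly, hH, ?_⟩
  refine tendsto_of_tendsto_of_tendsto_of_le_of_le tendsto_const_nhds ?_ (fun _ => zero_le) hdist
  simpa using ENNReal.tendsto_ofReal (tendsto_one_div_add_atTop_nhds_zero_nat (𝕜 := ℝ))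

lemma arithmeticKakeya_iff_tendsto_const_add_fM {m : ℕ → ℕ} (hm : Tendsto m atTop atTop) (n : ℕ) :
    ArithmeticKakeya ↔
      Tendsto (fun k => (((n : ℝ) - 1 : ℝ) : EReal) + fM (m k)) atTop (𝓝 (n : EReal)) := by
  have hmono : Monotone fun k => (fM k).toReal := fun k l h => by
    rw [← EReal.coe_le_coe_iff, coe_toReal_fM, coe_toReal_fM]
    exact fM_mono h
  have hlimit : (n : EReal) = (((n : ℝ) - 1 + 1 : ℝ) : EReal) := by
    rw [sub_add_cancel]
    rfl
  have hreal (k : ℕ) : (((n : ℝ) - 1 : ℝ) : EReal) + fM (m k) =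
      (((n : ℝ) - 1 + (fM (m k)).toReal : ℝ) : EReal) := by
    rw [EReal.coe_add, coe_toReal_fM]
  simp only [hreal]
  rw [hlimit, EReal.tendsto_coe, tendsto_const_add_iff, arithmeticKakeya_iff,
    tendsto_iff_tendsto_subseq_of_monotone hmono hm]
  rfl

end HarmonicPolytope

open HarmonicPolytope in
theorem mainTheorem4 (n : ℕ) [NeZero n] (hn : 1 < n) :
    (∀ (m s : ℕ) (u : Fin s → EuclideanSpace ℝ (Fin n)) (d j : Fin s → ℝ)
        (P : Set (EuclideanSpace ℝ (Fin n))),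
        IsPolytopeWith u d P → IsHarmonic u d j m →
          fM m = fP m ∧
          hM P = (((n : ℝ) - 1 : ℝ) : EReal) + fM m ∧
          hP P = (((n : ℝ) - 1 : ℝ) : EReal) + fM m) ∧
    ∃ P : ℕ → Set (EuclideanSpace ℝ (Fin n)),
      (∀ k, IsConvexPolytope (P k)) ∧
      Tendsto (fun k => Metric.hausdorffEDist (P k)
        (Metric.sphere (0 : EuclideanSpace ℝ (Fin n)) 1)) atTop (𝓝 0) ∧
      (ArithmeticKakeya ↔ Tendsto (fun k => hM (P k)) atTop (𝓝 (n : EReal))) ∧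
      (ArithmeticKakeya ↔ Tendsto (fun k => hP (P k)) atTop (𝓝 (n : EReal))) ∧
      (ArithmeticKakeya → Tendsto (fun k => gM (P k)) atTop (𝓝 (n : EReal))) ∧
      (ArithmeticKakeya → Tendsto (fun k => gP (P k)) atTop (𝓝 (n : EReal))) := by
  refine ⟨fun m s u d j P hPoly hH =>
    ⟨fM_eq_fP m, hM_eq hn hPoly hH, hP_eq hn hPoly hH⟩, ?_⟩
  obtain ⟨m, s, u, d, j, P, hm, hPoly, hH, hdist⟩ := exists_isHarmonic_tendsto_sphere hn
  have hMiff : ArithmeticKakeya ↔ Tendsto (fun k => hM (P k)) atTop (𝓝 (n : EReal)) := by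
    simpa only [hM_eq hn (hPoly _) (hH _)] using arithmeticKakeya_iff_tendsto_const_add_fM hm n
  have hPiff : ArithmeticKakeya ↔ Tendsto (fun k => hP (P k)) atTop (𝓝 (n : EReal)) := by
    simpa only [hP_eq hn (hPoly _) (hH _)] using arithmeticKakeya_iff_tendsto_const_add_fM hm n
  refine ⟨P, fun k => ⟨s k, u k, d k, hPoly k⟩, hdist, hMiff, hPiff, fun h => ?_, fun h => ?_⟩
  · exact tendsto_of_tendsto_of_tendsto_of_le_of_le (hMiff.1 h) tendsto_const_nhds
      (fun k => hM_le_gM (P k)) fun k => (hPoly k).gM_le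
  · exact tendsto_of_tendsto_of_tendsto_of_le_of_le (hPiff.1 h) tendsto_const_nhds
      (fun k => hP_le_gP (P k)) fun k => (leastDimP_le_leastDimM _ _).trans (hPoly k).gM_le
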